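/- Let $(M,g)$ be a compact smooth Riemannian manifold of dimension $d$ without boundary, with volume measure $dV_g$ and Laplace--Beltrami operator $\Delta_g$, regarded as a self-adjoint operator on the complex Hilbert space $L^2(M)=L^2(M,dV_g)$. A spectral parameter is a real number $\lambda\ge 0$ such that $-\lambda^2$ is an eigenvalue of $\Delta_g$; let $E_\lambda$ denote the orthogonal projection of $L^2(M)$ onto the eigenspace $\ker(\Delta_g+\lambda^2)$. For $f\in L^2(M)$ put $$\|f\|_{\widehat\ell^1}:=\sum_\lambda\|E_\lambda f\|_{L^2(M)}\in[0,\infty],$$ the sum being over all spectral parameters, and, if $f\ne 0$ and $\|f\|_{\widehat\ell^1}<\infty$, let $$\mathrm{FR}(f):=\frac{\|f\|_{\widehat\ell^1}}{\|f\|_{L^2(M)}}.$$ Theorem. Let $f\in L^2(M)$ be nonzero with $\|f\|_{\widehat\ell^1}<\infty$, and let $\eta>0$. Then for every natural number $k$ with $$k>\frac{\mathrm{FR}(f)^2-1}{\eta^2}$$ there exist spectral parameters $\lambda_1,\dots,\lambda_k$ (not necessarily distinct) and complex numbers $c_1,\dots,c_k$ such that each $E_{\lambda_i}f$ is nonzero,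 hence an eigenfunction of $\Delta_g$ with eigenvalue $-\lambda_i^2$, and the linear combination $P=\sum_{i=1}^k c_i\,E_{\lambda_i}f$ satisfies $$\|P-f\|_{L^2(M)}<\eta\,\|f\|_{L^2(M)}.$$ -/

import Mathlib

open MeasureTheory Filter Topology Bundle Manifold ContDiff

noncomputable section

/-- The model space `ℝᵈ` of a `d`-dimensional manifold. -/
abbrev ModelSpace (d : ℕ) : Type := EuclideanSpace ℝ (Fin d)

namespace RiemannianSpectral

section Volume

variable (d : ℕ) (M : Type*) [TopologicalSpace M] [ChartedSpace (ModelSpace d) M]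
  [RiemannianBundle (fun x : M => TangentSpace 𝓘(ℝ, ModelSpace d) x)]

/-- The coordinate vector field `∂ᵢ` of the chart at `c`, at the point with coordinates `y`. -/
def coordVector (c : M) (y : ModelSpace d) (i : Fin d) :
    TangentSpace 𝓘(ℝ, ModelSpace d) ((chartAt (ModelSpace d) c).symm y) :=
  mfderiv 𝓘(ℝ, ModelSpace d) 𝓘(ℝ, ModelSpace d) (chartAt (ModelSpace d) c).symm y
    (EuclideanSpace.single i (1 : ℝ) : ModelSpace d)

/-- The matrix `gᵢⱼ = g(∂ᵢ, ∂ⱼ)` of the metric in the chart at `c`. -/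
def metricMatrix (c : M) (y : ModelSpace d) : Matrix (Fin d) (Fin d) ℝ :=
  Matrix.of fun i j => inner ℝ (coordVector d M c y i) (coordVector d M c y j)

variable [MeasurableSpace M]

/-- The Riemannian volume of the domain of the chart at `c`: the image under the inverse chart of
the measure `√(det gᵢⱼ) dy` on the range of the chart, extended by zero to `M`. -/
def chartVolume (c : M) : Measure M :=
  ((volume.restrict (chartAt (ModelSpace d) c).target).withDensity
    (fun y => ENNReal.ofReal (√(metricMatrix d M c y).det))).map (chartAt (ModelSpace d) c).symm

/-- The Riemannian volume `dV_g`: it is equal to `√(det gᵢⱼ) dy` in every chart. As the measures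
`chartVolume d M c` agree on the overlaps of the charts, it is their supremum, that is, the smallest
measure on `M` above all of them. -/
def riemannianVolume : Measure M := ⨆ c : M, chartVolume d M c

/-- The complex Hilbert space `L²(M)`. -/
abbrev L2 : Type _ := Lp ℂ 2 (riemannianVolume d M)

end Volume

section Laplacian

variable {d : ℕ} {M : Type*} [TopologicalSpace M] [ChartedSpace (ModelSpace d) M]
  [RiemannianBundle (fun x : M => TangentSpace 𝓘(ℝ, ModelSpace d) x)]

variable (d) in
/-- Smooth complex-valued functions on `M`. -/
def IsSmooth (φ : M → ℂ) : Prop := ContMDiff 𝓘(ℝ, ModelSpace d) 𝓘(ℝ, ℂ) ∞ φ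

variable (d) in
/-- The derivative `dφ(v)` of a complex-valued function `φ` along a tangent vector `v` at `x`. -/
def dirDeriv (φ : M → ℂ) (x : M) (v : TangentSpace 𝓘(ℝ, ModelSpace d) x) : ℂ :=
  mfderiv 𝓘(ℝ, ModelSpace d) 𝓘(ℝ, ℂ) φ x v

instance finiteDimensional_tangentSpace (x : M) :
    FiniteDimensional ℝ (TangentSpace 𝓘(ℝ, ModelSpace d) x) :=
  inferInstanceAs (FiniteDimensional ℝ (ModelSpace d))

variable (d) in
/-- The pointwise pairing `⟨∇ψ, ∇φ⟩_g = ∑ᵢ conj (dψ(bᵢ)) dφ(bᵢ)`, where `b` is an orthonormal basis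
of the tangent space at `x` (the sum does not depend on `b`). It is conjugate-linear in `ψ`. -/
def gradInner (ψ φ : M → ℂ) (x : M) : ℂ :=
  ∑ i, (starRingEnd ℂ) (dirDeriv d ψ x
      (stdOrthonormalBasis ℝ (TangentSpace 𝓘(ℝ, ModelSpace d) x) i)) *
    dirDeriv d φ x (stdOrthonormalBasis ℝ (TangentSpace 𝓘(ℝ, ModelSpace d) x) i)

variable [MeasurableSpace M]

variable (d) in
/-- The Dirichlet form `∫_M ⟨∇ψ, ∇φ⟩_g dV_g` on smooth functions. -/
def dirichletForm (ψ φ : M → ℂ) : ℂ := ∫ x, gradInner d ψ φ x ∂(riemannianVolume d M)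

/-- The smooth functions `φ n` converge to `u` in the Sobolev space `H¹(M)`, the completion of
`C^∞(M)` in the norm `(‖φ‖² + ‖∇φ‖²)^(1/2)`: they converge to `u` in `L²(M)`, and their gradients
form a Cauchy sequence in `L²`. -/
structure IsH1Approx (φ : ℕ → M → ℂ) (u : L2 d M) : Prop where
  smooth : ∀ n, IsSmooth d (φ n)
  tendsto : Tendsto (fun n => eLpNorm (fun x => u x - φ n x) 2 (riemannianVolume d M)) atTop (𝓝 0)
  cauchy : Tendsto (fun p : ℕ × ℕ => ‖dirichletForm d (φ p.1 - φ p.2) (φ p.1 - φ p.2)‖)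
    atTop (𝓝 0)

/-- `u` lies in the domain of the Laplace--Beltrami operator `Δ_g` (the self-adjoint operator on
`L²(M)` with nonpositive spectrum) and `Δ_g u = w`: `u` is in `H¹(M)`, and
`∫ ⟨∇ψ, ∇u⟩_g = - ∫ conj ψ * w` for every smooth `ψ`, the left-hand side being the limit of
`∫ ⟨∇ψ, ∇φ n⟩_g` for smooth functions `φ n` that converge to `u` in `H¹(M)`. -/
def HasLaplacian (u w : L2 d M) : Prop :=
  ∃ φ : ℕ → M → ℂ, IsH1Approx φ u ∧
    ∀ ψ : M → ℂ, IsSmooth d ψ →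
      Tendsto (fun n => dirichletForm d ψ (φ n)) atTop
        (𝓝 (-∫ x, (starRingEnd ℂ) (ψ x) * w x ∂(riemannianVolume d M)))

/-- `u` is an eigenfunction of `Δ_g` with eigenvalue `-l²`. -/
def IsEigenfunction (l : ℝ) (u : L2 d M) : Prop :=
  u ≠ 0 ∧ HasLaplacian u ((-(l : ℂ) ^ 2) • u)

variable (d M) in
/-- The spectral parameters: the `l ≥ 0` for which `-l²` is an eigenvalue of `Δ_g`. -/
def spectralParameters : Set ℝ := {l | 0 ≤ l ∧ ∃ u : L2 d M, IsEigenfunction l u}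

variable (d M) in
/-- The eigenspace of `Δ_g` for `-l²`, as a closed subspace of `L²(M)` (it is zero when `-l²` is not
an eigenvalue). -/
def eigenspace (l : ℝ) : Submodule ℂ (L2 d M) :=
  (Submodule.span ℂ {u : L2 d M | IsEigenfunction l u}).topologicalClosure

variable (d M) in
/-- `E_l`, the orthogonal projection of `L²(M)` onto the eigenspace of `Δ_g` for `-l²`. -/
def spectralProjection (l : ℝ) : L2 d M →L[ℂ] L2 d M :=
  haveI : CompleteSpace (eigenspace d M l) := by unfold eigenspace; infer_instance
  (eigenspace d M l).starProjection

/-- `∑_l ‖E_l f‖`, the sum over the spectral parameters, as an element of `[0, ∞]`. -/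
def hatL1Norm (f : L2 d M) : ENNReal :=
  ∑' l : spectralParameters d M, ‖spectralProjection d M l f‖ₑ

/-- The Fourier ratio `(∑_l ‖E_l f‖) / ‖f‖`, for `f ≠ 0` with `∑_l ‖E_l f‖ < ∞`. -/
def fourierRatio (f : L2 d M) : ℝ := (hatL1Norm f).toReal / ‖f‖

end Laplacian

end RiemannianSpectral

end

/-! The proof joins Maurey's empirical method to the completeness of the eigenfunctions.

Sampling. Suppose `f = ∑ x i` converges absolutely in a Hilbert space and `A = ∑ ‖x i‖`. Then `f` is
the mean of a random vector of constant norm `A`, equal to `(A / ‖x i‖) • x i` with probability `‖x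
i‖ / A`, and its variance is `A ^ 2 - ‖f‖ ^ 2`. An average of `k` independent samples has mean
square error `(A ^ 2 - ‖f‖ ^ 2) / k`, which is below `η ^ 2 * ‖f‖ ^ 2` exactly under the hypothesis
on `k`. The samples are chosen one at a time, each no worse than the mean
(`exists_norm_add_sub_sq_le`), so no product probability space appears. The conclusion is
`exists_sparse_approximation`, applied to `x l = E_l f`.

Completeness. It remains to see that `∑ E_l f = f`. Let `J` be the inclusion of the `H¹` completion
of the smooth functions into `L²`. Then `J J*` is `(1 - Δ)⁻¹`: by `hasLaplacian_iff`, `Δ u = w`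
means `J J* (u - w) = u`. This operator is symmetric; it is injective because smooth functions are
dense in `L²`; it is compact by Rellich's theorem. The spectral theorem for compact symmetric
operators shows that its eigenspaces span a dense subspace, and its eigenvalues are the numbers `1 /
(1 + l ^ 2)` with `l` a spectral parameter.

Rellich's theorem is used in the form `hasFiniteRankControl_univ`: the `L²` norm is controlled by
finitely many integrals plus a small multiple of the Dirichlet energy. It follows from a Poincaré
inequality on small convex pieces of coordinate balls, where the metric is comparable with the
Euclidean one. -/

noncomputable section

namespace RiemannianSpectral

/-! ### A criterion for compactness of operators between Hilbert spaces. -/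

section Hilbert

variable {W H : Type*} [NormedAddCommGroup W] [InnerProductSpace ℂ W] [CompleteSpace W]
  [NormedAddCommGroup H] [InnerProductSpace ℂ H] [CompleteSpace H]

/-- An operator that is controlled, up to arbitrarily small multiples of the norm of the source, by
finitely many functionals of its values is compact. -/
theorem isCompactOperator_of_norm_sq_le (A : W →L[ℂ] H)
    (h : ∀ ε : ℝ, 0 < ε → ∃ (n : ℕ) (e : Fin n → H) (C : ℝ), ∀ v,
      ‖A v‖ ^ 2 ≤ C * ∑ i, ‖inner ℂ (e i) (A v)‖ ^ 2 + ε ^ 2 * ‖v‖ ^ 2) :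
    IsCompactOperator A := by
  have key : A ∈ closure {B : W →L[ℂ] H | IsCompactOperator B} := by
    rw [Metric.mem_closure_iff]
    intro ε hε
    obtain ⟨n, e, C, he⟩ := h (ε / 2) (half_pos hε)
    -- On the kernel `N` of the finitely many functionals, `A` has norm at most `ε / 2`. As `B` is
    -- injective on `Nᗮ`, that space is finite dimensional, so `A` composed with the projection onto
    -- `Nᗮ` is a compact operator within `ε` of `A`.
    let B : W →L[ℂ] (Fin n → ℂ) := ContinuousLinearMap.pi fun i => (innerSL ℂ (e i)).comp A
    let N : Submodule ℂ W := B.ker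
    have hNc : IsClosed (N : Set W) := B.isClosed_ker
    have : CompleteSpace N := hNc.completeSpace_coe
    have : FiniteDimensional ℂ Nᗮ := by
      refine FiniteDimensional.of_injective (B.toLinearMap.domRestrict Nᗮ) ?_
      rw [← LinearMap.ker_eq_bot, LinearMap.ker_eq_bot']
      intro m hm
      have h1 : (m : W) ∈ N := hm
      have h2 := Submodule.inner_right_of_mem_orthogonal h1 m.2
      exact Subtype.ext (inner_self_eq_zero.mp h2)
    refine ⟨A.comp (Nᗮ.starProjection), ?_, ?_⟩
    · have hc : IsCompactOperator (Nᗮ.orthogonalProjectionOnto) :=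
        have : ProperSpace Nᗮ := FiniteDimensional.proper ℂ _
        isCompactOperator_of_locallyCompactSpace_dom _
      exact hc.clm_comp (A.comp Nᗮ.subtypeL)
    · rw [dist_eq_norm]
      refine lt_of_le_of_lt (ContinuousLinearMap.opNorm_le_bound _ (half_pos hε).le ?_)
        (half_lt_self hε)
      intro v
      have h1 : (A - A.comp (Nᗮ.starProjection)) v = A (N.starProjection v) := by
        have := N.starProjection_add_starProjection_orthogonal v
        rw [sub_apply, ContinuousLinearMap.comp_apply, ← map_sub]
        congr 1
        rw [sub_eq_iff_eq_add]
        exact this.symm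
      rw [h1]
      have h2 : B (N.starProjection v) = 0 := N.starProjection_apply_mem v
      have h3 := he (N.starProjection v)
      have h4 : ∀ i, inner ℂ (e i) (A (N.starProjection v)) = 0 := fun i => congrFun h2 i
      simp only [h4, norm_zero, ne_eq, OfNat.ofNat_ne_zero, not_false_eq_true, zero_pow,
        Finset.sum_const_zero, mul_zero, zero_add] at h3
      have h5 : ‖A (N.starProjection v)‖ ≤ ε / 2 * ‖N.starProjection v‖ := by
        rw [← mul_pow] at h3
        exact le_of_sq_le_sq h3 (by positivity)
      refine h5.trans (mul_le_mul_of_nonneg_left ?_ (half_pos hε).le)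
      exact N.norm_starProjection_apply_le v
  rwa [IsClosed.closure_eq isClosed_setOfPred_isCompactOperator] at key

end Hilbert

/-! ### The solution operator of an abstract variational problem. -/

section Form

variable {V H : Type*} [SeminormedAddCommGroup V] [InnerProductSpace ℂ V]
  [NormedAddCommGroup H] [InnerProductSpace ℂ H] [CompleteSpace H]

/-- The extension of a bounded operator to the completion of its source. -/
def completionExtend (J : V →L[ℂ] H) : UniformSpace.Completion V →L[ℂ] H :=
  J.extend (UniformSpace.Completion.toComplL : V →L[ℂ] UniformSpace.Completion V)

theorem completionExtend_coe (J : V →L[ℂ] H) (v : V) :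
    completionExtend J (v : UniformSpace.Completion V) = J v :=
  ContinuousLinearMap.extend_eq J UniformSpace.Completion.denseRange_coe
    (UniformSpace.Completion.isUniformInducing_coe V) v

/-- The solution operator of the variational problem `⟪ψ, v⟫ = ⟪J ψ, w⟫`. -/
def solutionOperator (J : V →L[ℂ] H) : H →L[ℂ] H :=
  (completionExtend J).comp (ContinuousLinearMap.adjoint (completionExtend J))

/-- Symmetry, injectivity and positivity of `J J*` are all read off from this identity. -/
theorem inner_solutionOperator_left (J : V →L[ℂ] H) (x y : H) :
    inner ℂ (solutionOperator J x) y =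
      inner ℂ (ContinuousLinearMap.adjoint (completionExtend J) x)
        (ContinuousLinearMap.adjoint (completionExtend J) y) := by
  rw [ContinuousLinearMap.adjoint_inner_right]; rfl

theorem isSymmetric_solutionOperator (J : V →L[ℂ] H) :
    (solutionOperator J).IsSymmetric := by
  intro x y
  change inner ℂ (solutionOperator J x) y = inner ℂ x (solutionOperator J y)
  rw [inner_solutionOperator_left, ← inner_conj_symm x, inner_solutionOperator_left,
    inner_conj_symm]

/-- The estimate is a closed condition on `v`, so it passes from `V` to its completion and makes the
extended `J` compact. -/
theorem isCompactOperator_solutionOperator (J : V →L[ℂ] H)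
    (h : ∀ ε : ℝ, 0 < ε → ∃ (n : ℕ) (e : Fin n → H) (C : ℝ), ∀ v,
      ‖J v‖ ^ 2 ≤ C * ∑ i, ‖inner ℂ (e i) (J v)‖ ^ 2 + ε ^ 2 * ‖v‖ ^ 2) :
    IsCompactOperator (solutionOperator J) := by
  have : IsCompactOperator (completionExtend J) := by
    refine isCompactOperator_of_norm_sq_le _ fun ε hε => ?_
    obtain ⟨n, e, C, he⟩ := h ε hε
    refine ⟨n, e, C, fun v => ?_⟩
    induction v using UniformSpace.Completion.induction_on with
    | hp => exact isClosed_le (by fun_prop) (by fun_prop)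
    | ih v => simpa only [completionExtend_coe, UniformSpace.Completion.norm_coe] using he v
  exact this.comp_clm _

/-- The vector `J* w` represents the functional `ψ ↦ ⟪J ψ, w⟫` in the completion. Replacing it by a
Cauchy sequence from `V` gives a criterion without completions, in the shape of `HasLaplacian`. -/
theorem solutionOperator_eq_iff (J : V →L[ℂ] H) (w u : H) :
    solutionOperator J w = u ↔ ∃ φ : ℕ → V, CauchySeq φ ∧
      Tendsto (fun n => J (φ n)) atTop (𝓝 u) ∧
      ∀ ψ, Tendsto (fun n => inner ℂ ψ (φ n)) atTop (𝓝 (inner ℂ (J ψ) w)) := by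
  constructor
  · rintro rfl
    set v := ContinuousLinearMap.adjoint (completionExtend J) w with hv
    have hcl : v ∈ closure (Set.range ((↑) : V → UniformSpace.Completion V)) :=
      UniformSpace.Completion.denseRange_coe v
    obtain ⟨x, hx, hxv⟩ := mem_closure_iff_seq_limit.mp hcl
    choose φ hφ using hx
    obtain rfl : (fun n => (φ n : UniformSpace.Completion V)) = x := funext hφ
    refine ⟨φ, ?_, ?_, fun ψ => ?_⟩
    · exact (UniformSpace.Completion.isUniformInducing_coe V).cauchy_map_iff.mp
        (by rw [Filter.map_map]; exact hxv.cauchySeq)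
    · have := ((completionExtend J).continuous.tendsto v).comp hxv
      simp only [Function.comp_def, completionExtend_coe] at this
      exact this
    · have h1 : Tendsto (fun n => inner ℂ (ψ : UniformSpace.Completion V)
        (φ n : UniformSpace.Completion V)) atTop (𝓝 (inner ℂ (ψ : UniformSpace.Completion V) v)) :=
        (tendsto_const_nhds (x := (ψ : UniformSpace.Completion V))).inner hxv
      simpa only [UniformSpace.Completion.inner_coe, hv,
        ContinuousLinearMap.adjoint_inner_right, completionExtend_coe] using h1
  · rintro ⟨φ, hφ, hu, hw⟩
    have hc : CauchySeq (fun n => (φ n : UniformSpace.Completion V)) :=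
      by
      have := (UniformSpace.Completion.isUniformInducing_coe V).cauchy_map_iff.mpr hφ
      rwa [Filter.map_map] at this
    obtain ⟨v, hv⟩ := cauchySeq_tendsto_of_complete hc
    have h1 : completionExtend J v = u := by
      refine tendsto_nhds_unique (((completionExtend J).continuous.tendsto v).comp hv) ?_
      simpa only [Function.comp_def, completionExtend_coe] using hu
    have h2 : ContinuousLinearMap.adjoint (completionExtend J) w = v := by
      refine ext_inner_left ℂ fun x => ?_
      induction x using UniformSpace.Completion.induction_on with
      | hp => exact isClosed_eq (by fun_prop) (by fun_prop)
      | ih ψ =>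
        rw [ContinuousLinearMap.adjoint_inner_right, completionExtend_coe]
        refine tendsto_nhds_unique (hw ψ) ?_
        have h1 : Tendsto (fun n => inner ℂ (ψ : UniformSpace.Completion V)
          (φ n : UniformSpace.Completion V)) atTop
            (𝓝 (inner ℂ (ψ : UniformSpace.Completion V) v)) :=
          (tendsto_const_nhds (x := (ψ : UniformSpace.Completion V))).inner hv
        simpa only [UniformSpace.Completion.inner_coe] using h1
    rw [solutionOperator, ContinuousLinearMap.comp_apply, h2, h1]

/-- If `J J* w = 0` then `‖J* w‖ ^ 2 = 0`, so `w` is orthogonal to the dense range of `J`. -/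
theorem solutionOperator_injective (J : V →L[ℂ] H) (hJ : DenseRange J) :
    Function.Injective (solutionOperator J) := by
  rw [injective_iff_map_eq_zero]
  intro w hw
  have h1 : ContinuousLinearMap.adjoint (completionExtend J) w = 0 := by
    rw [← inner_self_eq_zero (𝕜 := ℂ), ← inner_solutionOperator_left, hw, inner_zero_left]
  have h2 : ∀ x : H, inner ℂ x w = 0 := by
    intro x
    induction x using hJ.induction_on with
    | hp => exact isClosed_eq (by fun_prop) (by fun_prop)
    | ih ψ =>
      rw [← completionExtend_coe, ← ContinuousLinearMap.adjoint_inner_right, h1, inner_zero_right]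
  exact inner_self_eq_zero.mp (h2 w)

theorem norm_completionExtend_le (J : V →L[ℂ] H) (hJ : ∀ v, ‖J v‖ ≤ ‖v‖)
    (v : UniformSpace.Completion V) : ‖completionExtend J v‖ ≤ ‖v‖ := by
  induction v using UniformSpace.Completion.induction_on with
  | hp => exact isClosed_le (by fun_prop) (by fun_prop)
  | ih v => simpa only [completionExtend_coe, UniformSpace.Completion.norm_coe] using hJ v

/-- The nonzero eigenvalues of the solution operator are of the form `1 / (1 + l²)`. -/
theorem exists_eq_of_solutionOperator_eq_smul (J : V →L[ℂ] H) (hJ : ∀ v, ‖J v‖ ≤ ‖v‖)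
    (hd : DenseRange J) {μ : ℂ} {u : H} (hu : u ≠ 0) (h : solutionOperator J u = μ • u) :
    ∃ l : ℝ, 0 ≤ l ∧ (1 + (l : ℂ) ^ 2) * μ = 1 := by
  set v := ContinuousLinearMap.adjoint (completionExtend J) u with hv
  have h1 : inner ℂ u (solutionOperator J u) = ((‖v‖ ^ 2 : ℝ) : ℂ) := by
    rw [← inner_conj_symm, inner_solutionOperator_left, inner_conj_symm, inner_self_eq_norm_sq_to_K]
    simp [hv]
  have hu2 : (0:ℝ) < ‖u‖ ^ 2 := by positivity
  have h2 : μ = ((‖v‖ ^ 2 / ‖u‖ ^ 2 : ℝ) : ℂ) := by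
    rw [h, inner_smul_right, inner_self_eq_norm_sq_to_K] at h1
    push_cast at h1 ⊢
    rw [eq_div_iff (by exact_mod_cast hu2.ne')]
    exact h1
  have hμ0 : μ ≠ 0 := by
    rintro rfl
    rw [zero_smul] at h
    exact hu (solutionOperator_injective J hd (h.trans (map_zero _).symm))
  have hv0 : ‖v‖ ≠ 0 := by
    intro h0
    apply hμ0
    rw [h2, h0]; simp
  -- With `v = J* u` and `J` a contraction, `‖v‖ ^ 2 = ⟪u, J v⟫ ≤ ‖u‖ * ‖v‖`. Hence `μ = ‖v‖ ^ 2 /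
  -- ‖u‖ ^ 2` is at most `1`, and `l ^ 2 = 1 / μ - 1` has a real solution.
  have hvu : ‖v‖ ≤ ‖u‖ := by
    have h3 : ‖v‖ ^ 2 ≤ ‖u‖ * ‖v‖ := by
      have h4 : ((‖v‖ ^ 2 : ℝ) : ℂ) = inner ℂ u (completionExtend J v) := h1.symm
      have h5 : ‖v‖ ^ 2 = ‖inner ℂ u (completionExtend J v)‖ := by
        rw [← h4, Complex.norm_real, Real.norm_of_nonneg (by positivity)]
      rw [h5]
      exact (norm_inner_le_norm _ _).trans
        (mul_le_mul_of_nonneg_left (norm_completionExtend_le J hJ v) (norm_nonneg _))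
    have h6 : 0 < ‖v‖ := lt_of_le_of_ne (norm_nonneg _) (Ne.symm hv0)
    nlinarith
  have h7 : 0 < ‖v‖ := lt_of_le_of_ne (norm_nonneg _) (Ne.symm hv0)
  have h8 : 0 ≤ ‖u‖ ^ 2 / ‖v‖ ^ 2 - 1 := by
    rw [sub_nonneg, le_div_iff₀ (by positivity), one_mul]
    exact pow_le_pow_left₀ h7.le hvu 2
  refine ⟨√(‖u‖ ^ 2 / ‖v‖ ^ 2 - 1), Real.sqrt_nonneg _, ?_⟩
  rw [h2, ← Complex.ofReal_pow, Real.sq_sqrt h8]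
  norm_cast
  field_simp
  ring

end Form

/-! ### Maurey's method, derandomised. -/

section Sampling

variable {H : Type*} [NormedAddCommGroup H] [InnerProductSpace ℂ H]

/-- One step in the choice of samples: if `∑ p i • z i = f` is a convex combination of vectors of
norm `A`, some `z i` with `p i > 0` is at most as far from `f` after addition of `s` as on
average. -/
theorem exists_norm_add_sub_sq_le {ι : Type*} {p : ι → ℝ} {z : ι → H} {f : H} {A : ℝ}
    (hp : ∀ i, 0 ≤ p i) (hp1 : HasSum p 1) (hz : HasSum (fun i => p i • z i) f)
    (hA : ∀ i, p i ≠ 0 → ‖z i‖ = A) (s : H) :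
    ∃ i, p i ≠ 0 ∧ ‖s + (z i - f)‖ ^ 2 ≤ ‖s‖ ^ 2 + (A ^ 2 - ‖f‖ ^ 2) := by
  by_contra! hcon
  set b : ℝ := ‖s‖ ^ 2 + (A ^ 2 - ‖f‖ ^ 2) with hb
  have hin : HasSum (fun i => p i * RCLike.re (inner ℂ (s - f) (z i)))
      (RCLike.re (inner ℂ (s - f) f)) := by
    have h1 := ((innerSL ℂ (s - f)).hasSum hz)
    have h2 := RCLike.hasSum_re ℂ h1
    convert h2 using 2 with i
    · rw [innerSL_apply_apply, ← Complex.coe_smul, inner_smul_right]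
      exact (Complex.re_ofReal_mul _ _).symm
    · rfl
  -- The mean of `‖s + (z i - f)‖ ^ 2` is exactly `b`, because `z i - f` has mean zero and variance
  -- `A ^ 2 - ‖f‖ ^ 2`. The values therefore cannot all exceed `b` where `p i ≠ 0`.
  have hsum : HasSum (fun i => p i * ‖s + (z i - f)‖ ^ 2) b := by
    have h3 : HasSum (fun i => p i * (‖s - f‖ ^ 2 + A ^ 2) +
        2 * (p i * RCLike.re (inner ℂ (s - f) (z i)))) 
        (1 * (‖s - f‖ ^ 2 + A ^ 2) + 2 * RCLike.re (inner ℂ (s - f) f)) :=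
      (hp1.mul_right _).add (hin.mul_left 2)
    convert h3 using 1
    · ext i
      by_cases hi : p i = 0
      · simp [hi]
      · have : s + (z i - f) = (s - f) + z i := by abel
        rw [this, norm_add_sq (𝕜 := ℂ), hA i hi]
        ring
    rw [norm_sub_sq (𝕜 := ℂ), inner_sub_left, map_sub, inner_self_eq_norm_sq, hb]
    ring
  have hle : ∀ i, p i * b ≤ p i * ‖s + (z i - f)‖ ^ 2 := by
    intro i
    by_cases hi : p i = 0
    · simp [hi]
    · exact mul_le_mul_of_nonneg_left (hcon i hi).le (hp i)
  obtain ⟨i, hi⟩ : ∃ i, p i ≠ 0 := by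
    by_contra! h0
    have : HasSum p 0 := by rw [show p = fun _ => 0 from funext h0]; exact hasSum_zero
    exact one_ne_zero (hp1.unique this)
  have hlt : p i * b < p i * ‖s + (z i - f)‖ ^ 2 :=
    mul_lt_mul_of_pos_left (hcon i hi) (lt_of_le_of_ne (hp i) (Ne.symm hi))
  have := hasSum_lt hle hlt (hp1.mul_right b) hsum
  simp at this

/-- Maurey's empirical method. -/
theorem exists_samples_norm_sum_sub_sq_le {ι : Type*} {p : ι → ℝ} {z : ι → H} {f : H} {A : ℝ}
    (hp : ∀ i, 0 ≤ p i) (hp1 : HasSum p 1) (hz : HasSum (fun i => p i • z i) f)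
    (hA : ∀ i, p i ≠ 0 → ‖z i‖ = A) (k : ℕ) :
    ∃ j : Fin k → ι, (∀ m, p (j m) ≠ 0) ∧
      ‖∑ m, (z (j m) - f)‖ ^ 2 ≤ k * (A ^ 2 - ‖f‖ ^ 2) := by
  induction k with
  | zero => exact ⟨Fin.elim0, fun m => m.elim0, by simp⟩
  | succ k ih =>
    obtain ⟨j, hj, hjs⟩ := ih
    obtain ⟨i, hi, his⟩ := exists_norm_add_sub_sq_le hp hp1 hz hA (∑ m, (z (j m) - f))
    refine ⟨Fin.snoc j i, fun m => ?_, ?_⟩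
    · induction m using Fin.lastCases with
      | last => simpa using hi
      | cast m => simpa using hj m
    · rw [Fin.sum_univ_castSucc]
      simp only [Fin.snoc_castSucc, Fin.snoc_last]
      push_cast
      linarith

/-- Sparse approximation of an absolutely convergent sum. -/
theorem exists_sparse_approximation {ι : Type*} {x : ι → H} {f : H} (hf : f ≠ 0)
    (hx : HasSum x f) (hs : Summable fun i => ‖x i‖) {η : ℝ} (hη : 0 < η) {k : ℕ}
    (hk : (((∑' i, ‖x i‖) / ‖f‖) ^ 2 - 1) / η ^ 2 < k) :
    ∃ (j : Fin k → ι) (c : Fin k → ℂ), (∀ m, x (j m) ≠ 0) ∧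
      ‖(∑ m, c m • x (j m)) - f‖ < η * ‖f‖ := by
  set A := ∑' i, ‖x i‖ with hAdef
  have hfpos : 0 < ‖f‖ := norm_pos_iff.mpr hf
  have hAf : ‖f‖ ≤ A := by rw [← hx.tsum_eq]; exact norm_tsum_le_tsum_norm hs
  have hApos : 0 < A := hfpos.trans_le hAf
  have hk' : A ^ 2 - ‖f‖ ^ 2 < k * (η ^ 2 * ‖f‖ ^ 2) := by
    rw [div_lt_iff₀ (by positivity), div_pow, sub_lt_iff_lt_add, div_lt_iff₀ (by positivity)] at hk
    linarith
  -- The case `k = 0` is impossible, as `‖f‖ ≤ A` makes the left side of `hk'` nonnegative.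
  have hkpos : 0 < (k : ℝ) := by
    by_contra! h0
    have : (k : ℝ) * (η ^ 2 * ‖f‖ ^ 2) ≤ 0 := mul_nonpos_of_nonpos_of_nonneg h0 (by positivity)
    nlinarith
  -- Each term is rescaled to norm `A` and weighted by its share of the total. A vanishing term has
  -- weight zero, so it is never sampled and its undefined quotient does no harm.
  obtain ⟨j, hj, hjs⟩ := exists_samples_norm_sum_sub_sq_le (p := fun i => ‖x i‖ / A)
    (z := fun i => ((A / ‖x i‖ : ℝ) : ℂ) • x i) (f := f) (A := A) (fun i => by positivity)
    (by simpa only [← hAdef, div_self hApos.ne'] using hs.hasSum.div_const A)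
    (by
      convert hx using 2 with i
      by_cases hi : x i = 0
      · simp [hi]
      · have : ‖x i‖ ≠ 0 := norm_ne_zero_iff.mpr hi
        rw [Complex.coe_smul, smul_smul]
        rw [show ‖x i‖ / A * (A / ‖x i‖) = 1 by field_simp, one_smul])
    (fun i hi => by
      have h0 : ‖x i‖ ≠ 0 := fun h => hi (by simp [h])
      rw [norm_smul, Complex.norm_real, Real.norm_of_nonneg (by positivity)]
      field_simp) k
  refine ⟨j, fun m => ((k : ℝ)⁻¹ * (A / ‖x (j m)‖) : ℝ), fun m hm => hj m (by simp [hm]), ?_⟩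
  have heq : (∑ m, (((k : ℝ)⁻¹ * (A / ‖x (j m)‖) : ℝ) : ℂ) • x (j m)) - f =
      ((k : ℝ)⁻¹ : ℝ) • ∑ m, (((A / ‖x (j m)‖ : ℝ) : ℂ) • x (j m) - f) := by
    rw [Finset.sum_sub_distrib, smul_sub, Finset.smul_sum]
    congr 1
    · refine Finset.sum_congr rfl fun m _ => ?_
      rw [Complex.coe_smul, Complex.coe_smul, smul_smul]
    · rw [Finset.sum_const, Finset.card_univ, Fintype.card_fin, ← Nat.cast_smul_eq_nsmul ℝ,
        smul_smul, inv_mul_cancel₀ hkpos.ne', one_smul]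
  rw [heq, norm_smul, Real.norm_of_nonneg (by positivity), inv_mul_lt_iff₀ hkpos]
  refine lt_of_pow_lt_pow_left₀ 2 (by positivity) (hjs.trans_lt ?_)
  calc (k : ℝ) * (A ^ 2 - ‖f‖ ^ 2) < k * (k * (η ^ 2 * ‖f‖ ^ 2)) :=
        mul_lt_mul_of_pos_left hk' hkpos
    _ = (k * (η * ‖f‖)) ^ 2 := by ring

end Sampling

/-! ### A Poincaré inequality on convex sets. -/

section Poincare

open scoped ENNReal

theorem sq_lintegral_le {α : Type*} [MeasurableSpace α] {ν : Measure α} {h : α → ℝ≥0∞}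
    (hh : AEMeasurable h ν) : (∫⁻ x, h x ∂ν) ^ 2 ≤ ν Set.univ * ∫⁻ x, h x ^ 2 ∂ν := by
  have h1 := ENNReal.lintegral_mul_le_Lp_mul_Lq ν Real.HolderConjugate.two_two hh
    (aemeasurable_const (b := (1 : ℝ≥0∞)))
  simp only [Pi.mul_apply, mul_one, ENNReal.rpow_two, one_pow, lintegral_const, one_mul] at h1
  calc (∫⁻ x, h x ∂ν) ^ 2 ≤
      ((∫⁻ x, h x ^ 2 ∂ν) ^ (1 / 2 : ℝ) * ν Set.univ ^ (1 / 2 : ℝ)) ^ 2 := by gcongr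
    _ = ν Set.univ * ∫⁻ x, h x ^ 2 ∂ν := by
      rw [mul_pow, ← ENNReal.rpow_two, ← ENNReal.rpow_two, ← ENNReal.rpow_mul, ← ENNReal.rpow_mul]
      norm_num
      rw [mul_comm]

/-- Tonelli, used to move the parameter along a segment outside the integrals over its endpoints. -/
theorem lintegral_const_mul_rotate {α β γ : Type*} [MeasurableSpace α] [MeasurableSpace β]
    [MeasurableSpace γ] (μ : Measure α) (ν : Measure β) (ρ : Measure γ) [SFinite μ] [SFinite ν]
    [SFinite ρ] {F : α × β × γ → ℝ≥0∞} (hF : Measurable F) (c : ℝ≥0∞) :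
    ∫⁻ y, ∫⁻ x, c * ∫⁻ t, F (y, x, t) ∂ρ ∂ν ∂μ =
      c * ∫⁻ t, ∫⁻ y, ∫⁻ x, F (y, x, t) ∂ν ∂μ ∂ρ := by
  have h1 : ∀ y, ∫⁻ x, ∫⁻ t, F (y, x, t) ∂ρ ∂ν = ∫⁻ t, ∫⁻ x, F (y, x, t) ∂ν ∂ρ := fun y =>
    lintegral_lintegral_swap (by
      exact (hF.comp (measurable_const.prodMk measurable_id)).aemeasurable)
  have h2 : Measurable fun p : α × β => ∫⁻ t, F (p.1, p.2, t) ∂ρ := by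
    have : Measurable fun q : (α × β) × γ => F (q.1.1, q.1.2, q.2) := hF.comp (by fun_prop)
    exact this.lintegral_prod_right'
  have h3 : Measurable fun p : α × γ => ∫⁻ x, F (p.1, x, p.2) ∂ν := by
    have : Measurable fun q : (α × γ) × β => F (q.1.1, q.2, q.1.2) := hF.comp (by fun_prop)
    exact this.lintegral_prod_right'
  have h4 : ∀ y, Measurable fun x => ∫⁻ t, F (y, x, t) ∂ρ := fun y =>
    h2.comp (measurable_const.prodMk measurable_id)
  have h5 : Measurable fun y => ∫⁻ x, ∫⁻ t, F (y, x, t) ∂ρ ∂ν := h2.lintegral_prod_right'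
  simp_rw [fun y => lintegral_const_mul (μ := ν) c (h4 y)]
  rw [lintegral_const_mul _ h5]
  simp_rw [h1]
  rw [lintegral_lintegral_swap h3.aemeasurable]

variable {E : Type*} [NormedAddCommGroup E] [NormedSpace ℝ E] [FiniteDimensional ℝ E]
  [MeasurableSpace E] [BorelSpace E] {μ : Measure E} [μ.IsAddHaarMeasure]

theorem lintegral_comp_smul_add (f : E → ℝ≥0∞) {t : ℝ} (ht : t ≠ 0) (a : E) :
    ∫⁻ x, f (t • x + a) ∂μ =
      ENNReal.ofReal |(t ^ Module.finrank ℝ E)⁻¹| * ∫⁻ x, f x ∂μ := by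
  have he : MeasurableEmbedding (fun x : E => t • x) := measurableEmbedding_const_smul₀ ht
  rw [← he.lintegral_map (μ := μ) (f := fun x => f (x + a)), Measure.map_addHaar_smul _ ht,
    lintegral_smul_measure, lintegral_add_right_eq_self f a, smul_eq_mul]

/-- The contraction towards `y` maps `Q` into itself by convexity. Its inverse Jacobian is `t⁻¹` to
the power of the dimension, and `t⁻¹ ≤ 2`. -/
theorem setLIntegral_comp_segment_le {Q : Set E} (hQ : Convex ℝ Q) (hQm : MeasurableSet Q)
    (G : E → ℝ≥0∞) {y : E} (hy : y ∈ Q) {t : ℝ} (ht : 1 / 2 ≤ t) (ht1 : t ≤ 1) :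
    ∫⁻ x in Q, G (y + t • (x - y)) ∂μ ≤ 2 ^ Module.finrank ℝ E * ∫⁻ x in Q, G x ∂μ := by
  have ht0 : 0 < t := by linarith
  rw [← lintegral_indicator hQm, ← lintegral_indicator hQm]
  calc ∫⁻ x, Q.indicator (fun x => G (y + t • (x - y))) x ∂μ
      ≤ ∫⁻ x, Q.indicator G (t • x + (1 - t) • y) ∂μ := by
        refine lintegral_mono fun x => ?_
        by_cases hx : x ∈ Q
        · have h1 : t • x + (1 - t) • y ∈ Q := hQ hx hy ht0.le (by linarith) (by ring)
          rw [Set.indicator_of_mem hx, Set.indicator_of_mem h1]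
          apply le_of_eq
          congr 1
          module
        · rw [Set.indicator_of_notMem hx]; exact zero_le
    _ = ENNReal.ofReal |(t ^ Module.finrank ℝ E)⁻¹| * ∫⁻ x, Q.indicator G x ∂μ :=
        lintegral_comp_smul_add _ ht0.ne' _
    _ ≤ 2 ^ Module.finrank ℝ E * ∫⁻ x, Q.indicator G x ∂μ := by
        gcongr
        rw [abs_of_pos (by positivity), ← inv_pow, ENNReal.ofReal_pow (by positivity)]
        gcongr
        rw [show (2 : ℝ≥0∞) = ENNReal.ofReal 2 by simp]
        apply ENNReal.ofReal_le_ofReal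
        rw [inv_le_comm₀ ht0 (by norm_num)]
        linarith

/-- For `t ≥ 1 / 2` the previous bound holds at each fixed `y`. For smaller `t` it would degenerate;
exchanging `x` and `y` replaces `t` by `1 - t`. -/
theorem lintegral_lintegral_comp_segment_le {Q : Set E} (hQ : Convex ℝ Q) (hQm : MeasurableSet Q)
    {G : E → ℝ≥0∞} (hG : Measurable G) {t : ℝ} (ht0 : 0 ≤ t) (ht1 : t ≤ 1) :
    ∫⁻ y in Q, ∫⁻ x in Q, G (y + t • (x - y)) ∂μ ∂μ ≤
      2 ^ Module.finrank ℝ E * μ Q * ∫⁻ x in Q, G x ∂μ := by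
  have key : ∀ s : ℝ, 1 / 2 ≤ s → s ≤ 1 → ∫⁻ y in Q, ∫⁻ x in Q, G (y + s • (x - y)) ∂μ ∂μ ≤
      2 ^ Module.finrank ℝ E * μ Q * ∫⁻ x in Q, G x ∂μ := by
    intro s hs hs1
    calc ∫⁻ y in Q, ∫⁻ x in Q, G (y + s • (x - y)) ∂μ ∂μ
        ≤ ∫⁻ _ in Q, 2 ^ Module.finrank ℝ E * ∫⁻ x in Q, G x ∂μ ∂μ :=
          setLIntegral_mono' hQm fun y hy => setLIntegral_comp_segment_le hQ hQm G hy hs hs1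
      _ = 2 ^ Module.finrank ℝ E * μ Q * ∫⁻ x in Q, G x ∂μ := by
          rw [setLIntegral_const]; ring
  rcases le_total (1 / 2) t with h | h
  · exact key t h ht1
  · rw [lintegral_lintegral_swap (by
      refine Measurable.aemeasurable ?_
      exact hG.comp (by fun_prop))]
    convert key (1 - t) (by linarith) (by linarith) using 6
    module

-- The fundamental theorem of calculus along the segment from `y` to `x`, followed by Cauchy–Schwarz
-- in the parameter.
omit [FiniteDimensional ℝ E] in
theorem enorm_sub_sq_le_lintegral_fderiv {F : Type*} [NormedAddCommGroup F] [NormedSpace ℝ F]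
    [CompleteSpace F] {Q U : Set E} (hQ : Convex ℝ Q) (hU : IsOpen U)
    (hQU : Q ⊆ U) {φ : E → F} (hφ : ContDiffOn ℝ 1 φ U) {x y : E} (hx : x ∈ Q) (hy : y ∈ Q) :
    ‖φ x - φ y‖ₑ ^ 2 ≤
      ‖x - y‖ₑ ^ 2 * ∫⁻ t in Set.Icc (0 : ℝ) 1, ‖fderiv ℝ φ (y + t • (x - y))‖ₑ ^ 2 := by
  have hmem : ∀ t ∈ Set.Icc (0 : ℝ) 1, y + t • (x - y) ∈ U := fun t ht =>
    hQU (hQ.add_smul_sub_mem hy hx ht)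
  have hc : ContDiffOn ℝ 1 (fun t : ℝ => φ (y + t • (x - y))) (Set.Icc 0 1) :=
    hφ.comp (by fun_prop) hmem
  have h1 := enorm_sub_le_lintegral_deriv_of_contDiffOn_Icc hc zero_le_one
  simp only [one_smul, zero_smul, add_zero, add_sub_cancel] at h1
  have h2 : ∀ t ∈ Set.Icc (0 : ℝ) 1, ‖deriv (fun t : ℝ => φ (y + t • (x - y))) t‖ₑ ≤
      ‖x - y‖ₑ * ‖fderiv ℝ φ (y + t • (x - y))‖ₑ := by
    intro t ht
    have hd : HasFDerivAt φ (fderiv ℝ φ (y + t • (x - y))) (y + t • (x - y)) :=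
      ((hφ.contDiffAt (hU.mem_nhds (hmem t ht))).differentiableAt one_ne_zero).hasFDerivAt
    have hl : HasDerivAt (fun t : ℝ => y + t • (x - y)) (x - y) t := by
      simpa using ((hasDerivAt_id t).smul_const (x - y)).const_add y
    have hdl : deriv (fun t : ℝ => φ (y + t • (x - y))) t =
        fderiv ℝ φ (y + t • (x - y)) (x - y) := (hd.comp_hasDerivAt t hl).deriv
    rw [hdl, mul_comm]
    exact ContinuousLinearMap.le_opENorm _ _
  have hm : Measurable fun t : ℝ => ‖fderiv ℝ φ (y + t • (x - y))‖ₑ :=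
    ((measurable_fderiv ℝ φ).comp (by fun_prop)).enorm
  calc ‖φ x - φ y‖ₑ ^ 2
      ≤ (∫⁻ t in Set.Icc (0 : ℝ) 1, ‖x - y‖ₑ * ‖fderiv ℝ φ (y + t • (x - y))‖ₑ) ^ 2 := by
        gcongr
        exact h1.trans (setLIntegral_mono' measurableSet_Icc h2)
    _ = ‖x - y‖ₑ ^ 2 * (∫⁻ t in Set.Icc (0 : ℝ) 1, ‖fderiv ℝ φ (y + t • (x - y))‖ₑ) ^ 2 := by
        rw [lintegral_const_mul _ hm, mul_pow]
    _ ≤ _ := by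
        gcongr
        simpa using sq_lintegral_le (ν := volume.restrict (Set.Icc (0 : ℝ) 1)) hm.aemeasurable

/-- A form of the Poincaré inequality on convex sets. -/
theorem lintegral_lintegral_enorm_sub_sq_le {F : Type*} [NormedAddCommGroup F] [NormedSpace ℝ F]
    [CompleteSpace F] {Q U : Set E} (hQ : Convex ℝ Q) (hQm : MeasurableSet Q) (hU : IsOpen U)
    (hQU : Q ⊆ U) {φ : E → F} (hφ : ContDiffOn ℝ 1 φ U) {δ : ℝ≥0∞}
    (hδ : ∀ x ∈ Q, ∀ y ∈ Q, ‖x - y‖ₑ ≤ δ) :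
    ∫⁻ y in Q, ∫⁻ x in Q, ‖φ x - φ y‖ₑ ^ 2 ∂μ ∂μ ≤
      δ ^ 2 * (2 ^ Module.finrank ℝ E * μ Q * ∫⁻ x in Q, ‖fderiv ℝ φ x‖ₑ ^ 2 ∂μ) := by
  set G : E → ℝ≥0∞ := fun x => ‖fderiv ℝ φ x‖ₑ ^ 2 with hGdef
  have hG : Measurable G := (measurable_fderiv ℝ φ).enorm.pow_const 2
  calc ∫⁻ y in Q, ∫⁻ x in Q, ‖φ x - φ y‖ₑ ^ 2 ∂μ ∂μ
      ≤ ∫⁻ y in Q, ∫⁻ x in Q, δ ^ 2 * ∫⁻ t in Set.Icc (0 : ℝ) 1, G (y + t • (x - y)) ∂volume ∂μ ∂μ := by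
        refine setLIntegral_mono' hQm fun y hy => setLIntegral_mono' hQm fun x hx => ?_
        refine (enorm_sub_sq_le_lintegral_fderiv hQ hU hQU hφ hx hy).trans ?_
        gcongr
        exact hδ x hx y hy
    _ = δ ^ 2 * ∫⁻ t in Set.Icc (0 : ℝ) 1,
          ∫⁻ y in Q, ∫⁻ x in Q, G (y + t • (x - y)) ∂μ ∂μ ∂volume := by
        have hm : Measurable fun p : E × E × ℝ => G (p.1 + p.2.2 • (p.2.1 - p.1)) :=
          hG.comp (by fun_prop)
        exact lintegral_const_mul_rotate (μ.restrict Q) (μ.restrict Q)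
          (volume.restrict (Set.Icc (0 : ℝ) 1)) hm (δ ^ 2)
    _ ≤ δ ^ 2 * ∫⁻ _ in Set.Icc (0 : ℝ) 1,
          2 ^ Module.finrank ℝ E * μ Q * ∫⁻ x in Q, G x ∂μ ∂volume := by
        refine mul_le_mul' le_rfl (setLIntegral_mono' measurableSet_Icc fun t ht => ?_)
        exact lintegral_lintegral_comp_segment_le hQ hQm hG ht.1 ht.2
    _ = _ := by simp

/-- The mean square is controlled by the mean and the mean square oscillation. -/
theorem lintegral_enorm_sq_le_average {α : Type*} [MeasurableSpace α] {ν : Measure α}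
    [IsFiniteMeasure ν] {φ : α → ℂ} (hφ : Measurable φ) (hi : Integrable φ ν) :
    ν Set.univ * ∫⁻ x, ‖φ x‖ₑ ^ 2 ∂ν ≤
      2 * ‖∫ x, φ x ∂ν‖ₑ ^ 2 + 2 * ∫⁻ x, ∫⁻ y, ‖φ y - φ x‖ₑ ^ 2 ∂ν ∂ν := by
  set m := ν Set.univ with hm
  have hmtop : m ≠ ⊤ := measure_ne_top _ _
  by_cases hm0 : m = 0
  · rw [hm0, zero_mul]; exact zero_le
  -- Pointwise, `m * φ x = ∫ φ - ∫ (φ y - φ x) dy`. The factors `2` come from `(a + b) ^ 2 ≤ 2 * (a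
  -- ^ 2 + b ^ 2)`, the factor `m` from Cauchy–Schwarz. Integrating in `x` leaves one superfluous
  -- factor `m` to cancel.
  have hpt : ∀ x, m ^ 2 * ‖φ x‖ₑ ^ 2 ≤
      2 * ‖∫ x, φ x ∂ν‖ₑ ^ 2 + 2 * (m * ∫⁻ y, ‖φ y - φ x‖ₑ ^ 2 ∂ν) := by
    intro x
    have h1 : m * ‖φ x‖ₑ = ‖(m.toReal : ℂ) * φ x‖ₑ := by
      rw [enorm_mul]
      congr 1
      rw [← ofReal_norm, Complex.norm_real, Real.norm_of_nonneg ENNReal.toReal_nonneg,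
        ENNReal.ofReal_toReal hmtop]
    have h2 : (m.toReal : ℂ) * φ x = ∫ y, φ y ∂ν - ∫ y, (φ y - φ x) ∂ν := by
      rw [integral_sub hi (integrable_const _), integral_const, sub_sub_cancel]
      simp [hm, measureReal_def]
    have h3 : m * ‖φ x‖ₑ ≤ ‖∫ y, φ y ∂ν‖ₑ + ∫⁻ y, ‖φ y - φ x‖ₑ ∂ν := by
      rw [h1, h2]
      exact (enorm_sub_le).trans (by gcongr; exact enorm_integral_le_lintegral_enorm _)
    calc m ^ 2 * ‖φ x‖ₑ ^ 2 = (m * ‖φ x‖ₑ) ^ 2 := by ring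
      _ ≤ (‖∫ y, φ y ∂ν‖ₑ + ∫⁻ y, ‖φ y - φ x‖ₑ ∂ν) ^ 2 := by gcongr
      _ ≤ 2 * ‖∫ x, φ x ∂ν‖ₑ ^ 2 + 2 * (∫⁻ y, ‖φ y - φ x‖ₑ ∂ν) ^ 2 := by
        rw [← mul_add]
        have := ENNReal.rpow_add_le_mul_rpow_add_rpow (‖∫ y, φ y ∂ν‖ₑ)
          (∫⁻ y, ‖φ y - φ x‖ₑ ∂ν) (p := 2) one_le_two
        norm_num at this
        exact this
      _ ≤ _ := by
        gcongr
        exact sq_lintegral_le (by fun_prop)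
  have hmm : Measurable fun x => ∫⁻ y, ‖φ y - φ x‖ₑ ^ 2 ∂ν := by
    have : Measurable fun p : α × α => ‖φ p.2 - φ p.1‖ₑ ^ 2 := by fun_prop
    exact this.lintegral_prod_right'
  have hint := lintegral_mono (μ := ν) hpt
  rw [lintegral_const_mul _ (by fun_prop), lintegral_add_left measurable_const, lintegral_const,
    lintegral_const_mul _ (by fun_prop), lintegral_const_mul _ hmm, ← hm] at hint
  rw [← ENNReal.mul_le_mul_iff_right hm0 hmtop]
  calc m * (m * ∫⁻ x, ‖φ x‖ₑ ^ 2 ∂ν) = m ^ 2 * ∫⁻ x, ‖φ x‖ₑ ^ 2 ∂ν := by ring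
    _ ≤ _ := hint
    _ = _ := by ring

end Poincare

/-! ### Cutting a bounded convex set into small convex pieces. -/

section Grid

/-- The pieces are the intersections of `K` with half-open grid cubes of side `s`, whose points lie
within `√d * s` of each other. Boundedness leaves finitely many cubes. -/
theorem exists_convex_partition {d : ℕ} {K : Set (EuclideanSpace ℝ (Fin d))}
    (hK : Convex ℝ K) (hKm : MeasurableSet K) (hKb : Bornology.IsBounded K) {δ : ℝ} (hδ : 0 < δ) :
    ∃ (n : ℕ) (Q : Fin n → Set (EuclideanSpace ℝ (Fin d))),
      (∀ i, Convex ℝ (Q i)) ∧ (∀ i, MeasurableSet (Q i)) ∧ (∀ i, Q i ⊆ K) ∧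
      Pairwise (Function.onFun Disjoint Q) ∧ K ⊆ ⋃ i, Q i ∧
      ∀ i, ∀ x ∈ Q i, ∀ y ∈ Q i, ‖x - y‖ ≤ δ := by
  obtain ⟨s, hs, hsδ⟩ : ∃ s : ℝ, 0 < s ∧ √d * s ≤ δ := by
    -- The `+ 1` keeps the denominator positive when `d = 0`.
    refine ⟨δ / (√d + 1), by positivity, ?_⟩
    rw [mul_div_assoc', div_le_iff₀ (by positivity)]
    nlinarith [Real.sqrt_nonneg (d : ℝ)]
  let g : EuclideanSpace ℝ (Fin d) → (Fin d → ℤ) := fun y i => ⌊y i / s⌋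
  obtain ⟨R, hR⟩ := hKb.exists_norm_le
  let S : Finset (Fin d → ℤ) := Fintype.piFinset fun _ => Finset.Icc ⌊-R / s⌋ ⌊R / s⌋
  have hgS : ∀ y ∈ K, g y ∈ S := by
    intro y hy
    rw [Fintype.mem_piFinset]
    intro i
    have h1 : |y i| ≤ R := by
      have := PiLp.norm_apply_le y i
      exact this.trans (hR y hy)
    rw [abs_le] at h1
    rw [Finset.mem_Icc]
    exact ⟨Int.floor_mono (by gcongr; exact h1.1), Int.floor_mono (by gcongr; exact h1.2)⟩
  have hfib : ∀ k : Fin d → ℤ, g ⁻¹' {k} = ⋂ i, {y | (k i : ℝ) * s ≤ y i ∧ y i < (k i + 1) * s} := by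
    intro k
    ext y
    simp only [Set.mem_preimage, Set.mem_singleton_iff, funext_iff, Set.mem_iInter,
      Set.mem_ofPred_eq, g, Int.floor_eq_iff, le_div_iff₀ hs, div_lt_iff₀ hs]
  refine ⟨S.card, fun i => K ∩ g ⁻¹' {(S.equivFin.symm i : Fin d → ℤ)}, fun i => ?_, fun i => ?_,
    fun i => Set.inter_subset_left, ?_, ?_, ?_⟩
  · refine hK.inter ?_
    rw [hfib]
    refine convex_iInter fun j => ?_
    have hl : IsLinearMap ℝ (fun y : EuclideanSpace ℝ (Fin d) => y j) := ⟨by simp, by simp⟩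
    exact (convex_halfSpace_ge hl _).inter (convex_halfSpace_lt hl _)
  · refine hKm.inter ?_
    rw [hfib]
    refine MeasurableSet.iInter fun j => ?_
    have hl : Measurable fun y : EuclideanSpace ℝ (Fin d) => y j := by fun_prop
    exact (hl measurableSet_Ici).inter (hl measurableSet_Iio)
  · intro i j hij
    refine Disjoint.mono Set.inter_subset_right Set.inter_subset_right ?_
    refine Disjoint.preimage _ ?_
    rw [Set.disjoint_singleton]
    exact fun h => hij (S.equivFin.symm.injective (Subtype.ext h))
  · intro y hy
    rw [Set.mem_iUnion]
    exact ⟨S.equivFin ⟨g y, hgS y hy⟩, hy, by simp⟩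
  · rintro i x ⟨-, hx⟩ y ⟨-, hy⟩
    rw [hfib, Set.mem_iInter] at hx hy
    rw [EuclideanSpace.norm_eq]
    refine le_trans ?_ hsδ
    calc √(∑ j, ‖(x - y) j‖ ^ 2) ≤ √(∑ _j : Fin d, s ^ 2) := by
          gcongr with j
          obtain ⟨h1, h2⟩ := hx j
          obtain ⟨h3, h4⟩ := hy j
          rw [Real.norm_eq_abs, PiLp.sub_apply, abs_le]
          constructor <;> nlinarith
      _ = √d * s := by
          rw [Finset.sum_const, Finset.card_univ, Fintype.card_fin, nsmul_eq_mul,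
            Real.sqrt_mul (by positivity), Real.sqrt_sq hs.le]

end Grid

/-! ### Gram determinants. -/

section GramDet

variable {d : ℕ} {T : Type*} [NormedAddCommGroup T] [InnerProductSpace ℝ T]

/-- The Gram matrix transforms as `Jᵀ * G * J`, with `J` the matrix of `L`; this is the change of
the metric under new coordinates. -/
theorem det_gram_comp (A : ModelSpace d →ₗ[ℝ] T) (L : ModelSpace d →ₗ[ℝ] ModelSpace d) :
    (Matrix.gram ℝ fun i => A (L (EuclideanSpace.single i 1))).det =
      LinearMap.det L ^ 2 * (Matrix.gram ℝ fun i => A (EuclideanSpace.single i 1)).det := by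
  set b := (EuclideanSpace.basisFun (Fin d) ℝ).toBasis with hb
  have hbi : ∀ i, b i = EuclideanSpace.single i (1 : ℝ) := fun i => by simp [hb]
  set J := LinearMap.toMatrix b b L with hJ
  have hL : ∀ i, L (EuclideanSpace.single i 1) =
      ∑ k, J k i • (EuclideanSpace.single k (1 : ℝ) : ModelSpace d) := by
    intro i
    rw [← hbi, ← b.sum_repr (L (b i))]
    simp only [hJ, LinearMap.toMatrix_apply, hbi]
  have hG : (Matrix.gram ℝ fun i => A (L (EuclideanSpace.single i 1))) =
      J.transpose * (Matrix.gram ℝ fun i => A (EuclideanSpace.single i 1)) * J := by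
    ext i j
    simp only [Matrix.gram_apply, hL, map_sum, map_smul, sum_inner, inner_sum, inner_smul_left,
      inner_smul_right, Matrix.mul_apply, Matrix.transpose_apply, Finset.sum_mul, Finset.mul_sum]
    refine Finset.sum_congr rfl fun k _ => Finset.sum_congr rfl fun l _ => ?_
    simp only [conj_trivial]
    ring
  rw [hG, Matrix.det_mul, Matrix.det_mul, Matrix.det_transpose, hJ, LinearMap.det_toMatrix]
  ring

theorem det_gram_pos (A : ModelSpace d →ₗ[ℝ] T) (hA : Function.Injective A) :
    0 < (Matrix.gram ℝ fun i => A (EuclideanSpace.single i (1 : ℝ))).det := by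
  refine (Matrix.posDef_gram_of_linearIndependent ?_).det_pos
  have hb := ((EuclideanSpace.basisFun (Fin d) ℝ).toBasis.linearIndependent).map' A
    (LinearMap.ker_eq_bot.mpr hA)
  have he : (⇑A ∘ ⇑(EuclideanSpace.basisFun (Fin d) ℝ).toBasis) =
      fun i => A (EuclideanSpace.single i (1 : ℝ)) := by
    ext i
    simp
  rwa [he] at hb

end GramDet

/-! ### The metric in coordinates and its behaviour under a change of chart. -/

section Charts

variable {d : ℕ} {M : Type*} [TopologicalSpace M] [ChartedSpace (ModelSpace d) M]
  [IsManifold 𝓘(ℝ, ModelSpace d) ∞ M]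

theorem continuousOn_coordVector (c : M) (i : Fin d) :
    ContinuousOn (fun y => (⟨(chartAt (ModelSpace d) c).symm y,
      mfderiv 𝓘(ℝ, ModelSpace d) 𝓘(ℝ, ModelSpace d) (chartAt (ModelSpace d) c).symm y
        (EuclideanSpace.single i (1 : ℝ) : ModelSpace d)⟩ :
          TotalSpace (ModelSpace d) (fun x : M => TangentSpace 𝓘(ℝ, ModelSpace d) x)))
      (chartAt (ModelSpace d) c).target := by
  have h1 := (contMDiffOn_chart_symm (I := 𝓘(ℝ, ModelSpace d)) (n := ∞)
    (x := c)).continuousOn_tangentMapWithin (by simp)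
      (chartAt (ModelSpace d) c).open_target.uniqueMDiffOn
  have h2 : Continuous fun y : ModelSpace d =>
      (⟨y, (EuclideanSpace.single i (1 : ℝ) : ModelSpace d)⟩ :
        TangentBundle 𝓘(ℝ, ModelSpace d) (ModelSpace d)) :=
    (tangentBundleModelSpaceHomeomorph 𝓘(ℝ, ModelSpace d)).symm.continuous.comp
      (Continuous.prodMk continuous_id continuous_const)
  have h3 := h1.comp h2.continuousOn (s := (chartAt (ModelSpace d) c).target) (fun y hy => hy)
  refine h3.congr fun y hy => ?_
  simp only [tangentMapWithin, Function.comp_def]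
  rw [mfderivWithin_of_isOpen (chartAt (ModelSpace d) c).open_target hy]

theorem mfderiv_chart_symm_injective (c : M) {y : ModelSpace d}
    (hy : y ∈ (chartAt (ModelSpace d) c).target) :
    Function.Injective (mfderiv 𝓘(ℝ, ModelSpace d) 𝓘(ℝ, ModelSpace d)
      (chartAt (ModelSpace d) c).symm y) :=
  (mdifferentiable_chart (I := 𝓘(ℝ, ModelSpace d)) c).symm.mfderiv_injective hy

/-- Near `y` the inverse chart at `c` is the inverse chart at `c'` composed with the transition map,
so the chain rule applies. -/
theorem mfderiv_chart_symm_change (c c' : M) {y : ModelSpace d}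
    (hy : y ∈ (chartAt (ModelSpace d) c).target)
    (hy' : (chartAt (ModelSpace d) c).symm y ∈ (chartAt (ModelSpace d) c').source) :
    DifferentiableAt ℝ (chartAt (ModelSpace d) c' ∘ (chartAt (ModelSpace d) c).symm) y ∧
    ∀ v : ModelSpace d, (mfderiv 𝓘(ℝ, ModelSpace d) 𝓘(ℝ, ModelSpace d)
      (chartAt (ModelSpace d) c).symm y v : ModelSpace d) =
      mfderiv 𝓘(ℝ, ModelSpace d) 𝓘(ℝ, ModelSpace d) (chartAt (ModelSpace d) c').symm
        (chartAt (ModelSpace d) c' ((chartAt (ModelSpace d) c).symm y))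
        (fderiv ℝ (chartAt (ModelSpace d) c' ∘ (chartAt (ModelSpace d) c).symm) y v :
          ModelSpace d) := by
  set e := chartAt (ModelSpace d) c
  set e' := chartAt (ModelSpace d) c'
  have he : MDifferentiableAt 𝓘(ℝ, ModelSpace d) 𝓘(ℝ, ModelSpace d) e.symm y :=
    (mdifferentiable_chart (I := 𝓘(ℝ, ModelSpace d)) c).mdifferentiableAt_symm hy
  have he' : MDifferentiableAt 𝓘(ℝ, ModelSpace d) 𝓘(ℝ, ModelSpace d) e' (e.symm y) :=
    (mdifferentiable_chart (I := 𝓘(ℝ, ModelSpace d)) c').mdifferentiableAt hy'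
  have hes : MDifferentiableAt 𝓘(ℝ, ModelSpace d) 𝓘(ℝ, ModelSpace d) e'.symm (e' (e.symm y)) :=
    (mdifferentiable_chart (I := 𝓘(ℝ, ModelSpace d)) c').mdifferentiableAt_symm
      (e'.map_source hy')
  have hτ : MDifferentiableAt 𝓘(ℝ, ModelSpace d) 𝓘(ℝ, ModelSpace d) (e' ∘ e.symm) y :=
    he'.comp y he
  have hd : DifferentiableAt ℝ (e' ∘ e.symm) y := hτ.differentiableAt
  refine ⟨hd, fun v => ?_⟩
  have h1 : HasMFDerivAt 𝓘(ℝ, ModelSpace d) 𝓘(ℝ, ModelSpace d) (e'.symm ∘ (e' ∘ e.symm)) y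
      ((mfderiv 𝓘(ℝ, ModelSpace d) 𝓘(ℝ, ModelSpace d) e'.symm (e' (e.symm y))).comp
        (fderiv ℝ (e' ∘ e.symm) y)) :=
    HasMFDerivAt.comp y (g := e'.symm) (f := e' ∘ e.symm) hes.hasMFDerivAt
      hd.hasFDerivAt.hasMFDerivAt
  have hev : e.symm =ᶠ[𝓝 y] (e'.symm ∘ (e' ∘ e.symm)) := by
    have : ∀ᶠ z in 𝓝 y, e.symm z ∈ e'.source :=
      (e.continuousAt_symm hy).eventually_mem (e'.open_source.mem_nhds hy')
    filter_upwards [this] with z hz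
    exact (e'.left_inv hz).symm
  have h2 := h1.congr_of_eventuallyEq hev
  exact congrArg (fun L : ModelSpace d →L[ℝ] ModelSpace d => L v) h2.mfderiv

variable [RiemannianBundle (fun x : M => TangentSpace 𝓘(ℝ, ModelSpace d) x)]

-- All tangent spaces are definitionally the model space, but their inner products depend on the
-- base point. This transports them when a base point is rewritten by the inverse laws of a chart.
omit [IsManifold 𝓘(ℝ, ModelSpace d) ∞ M] in
theorem inner_tangentSpace_congr {p q : M} (h : p = q) (u v : ModelSpace d) :
    inner ℝ (E := TangentSpace 𝓘(ℝ, ModelSpace d) p) u v =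
      inner ℝ (E := TangentSpace 𝓘(ℝ, ModelSpace d) q) u v := by
  subst h; rfl

theorem det_metricMatrix_change (c c' : M) {y : ModelSpace d}
    (hy : y ∈ (chartAt (ModelSpace d) c).target)
    (hy' : (chartAt (ModelSpace d) c).symm y ∈ (chartAt (ModelSpace d) c').source) :
    (metricMatrix d M c y).det =
      (fderiv ℝ (chartAt (ModelSpace d) c' ∘ (chartAt (ModelSpace d) c).symm) y).det ^ 2 *
      (metricMatrix d M c' (chartAt (ModelSpace d) c' ((chartAt (ModelSpace d) c).symm y))).det := by
  set e := chartAt (ModelSpace d) c with he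
  set e' := chartAt (ModelSpace d) c' with he'
  obtain ⟨-, h⟩ := mfderiv_chart_symm_change c c' hy hy'
  have hp : e'.symm (e' (e.symm y)) = e.symm y := e'.left_inv hy'
  have key := det_gram_comp (T := TangentSpace 𝓘(ℝ, ModelSpace d) (e'.symm (e' (e.symm y))))
    (mfderiv 𝓘(ℝ, ModelSpace d) 𝓘(ℝ, ModelSpace d) e'.symm (e' (e.symm y))).toLinearMap
    (fderiv ℝ (e' ∘ e.symm) y).toLinearMap
  refine Eq.trans ?_ key
  congr 1
  ext i j
  change inner ℝ (coordVector d M c y i) (coordVector d M c y j) = _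
  rw [Matrix.gram_apply]
  refine Eq.trans ?_ (inner_tangentSpace_congr hp.symm _ _)
  unfold coordVector
  have hi := h (EuclideanSpace.single i 1)
  have hj := h (EuclideanSpace.single j 1)
  rw [show mfderiv 𝓘(ℝ, ModelSpace d) 𝓘(ℝ, ModelSpace d) (chartAt (ModelSpace d) c).symm y
    (EuclideanSpace.single i 1 : ModelSpace d) = _ from hi,
    show mfderiv 𝓘(ℝ, ModelSpace d) 𝓘(ℝ, ModelSpace d) (chartAt (ModelSpace d) c).symm y
    (EuclideanSpace.single j 1 : ModelSpace d) = _ from hj]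
  rfl

theorem det_metricMatrix_pos (c : M) {y : ModelSpace d}
    (hy : y ∈ (chartAt (ModelSpace d) c).target) : 0 < (metricMatrix d M c y).det :=
  det_gram_pos (T := TangentSpace 𝓘(ℝ, ModelSpace d) ((chartAt (ModelSpace d) c).symm y))
    (mfderiv 𝓘(ℝ, ModelSpace d) 𝓘(ℝ, ModelSpace d) (chartAt (ModelSpace d) c).symm y).toLinearMap
    (mfderiv_chart_symm_injective c hy)

variable [IsContMDiffRiemannianBundle 𝓘(ℝ, ModelSpace d) ∞ (ModelSpace d)
      (fun x : M => TangentSpace 𝓘(ℝ, ModelSpace d) x)]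

theorem continuousOn_metricMatrix (c : M) :
    ContinuousOn (metricMatrix d M c) (chartAt (ModelSpace d) c).target := by
  have : IsContinuousRiemannianBundle (ModelSpace d)
      (fun x : M => TangentSpace 𝓘(ℝ, ModelSpace d) x) := by
    obtain ⟨g, hg, hgi⟩ := IsContMDiffRiemannianBundle.exists_contMDiff
      (IB := 𝓘(ℝ, ModelSpace d)) (n := ∞) (F := ModelSpace d)
      (E := fun x : M => TangentSpace 𝓘(ℝ, ModelSpace d) x)
    exact ⟨g, hg.continuous, hgi⟩
  refine continuousOn_pi.mpr fun i => continuousOn_pi.mpr fun j => ?_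
  exact (continuousOn_coordVector c i).inner_bundle (continuousOn_coordVector c j)

theorem continuousOn_sqrt_det (c : M) :
    ContinuousOn (fun y => √(metricMatrix d M c y).det) (chartAt (ModelSpace d) c).target := by
  have h : Continuous fun A : Matrix (Fin d) (Fin d) ℝ => √A.det := by
    exact Real.continuous_sqrt.comp (Continuous.matrix_det continuous_id)
  exact h.comp_continuousOn (continuousOn_metricMatrix c)

end Charts

/-! ### The Riemannian volume is given by the density in each chart. -/

section Volume

open scoped ENNReal NNReal

variable {d : ℕ} {M : Type*} [TopologicalSpace M] [ChartedSpace (ModelSpace d) M]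
  [IsManifold 𝓘(ℝ, ModelSpace d) ∞ M]
  [RiemannianBundle (fun x : M => TangentSpace 𝓘(ℝ, ModelSpace d) x)]
  [IsContMDiffRiemannianBundle 𝓘(ℝ, ModelSpace d) ∞ (ModelSpace d)
      (fun x : M => TangentSpace 𝓘(ℝ, ModelSpace d) x)]
  [MeasurableSpace M] [BorelSpace M]

variable (d M) in
/-- The density of the Riemannian volume in the chart at `c`. -/
def chartDensity (c : M) (y : ModelSpace d) : ℝ≥0∞ :=
  ENNReal.ofReal (√(metricMatrix d M c y).det)

omit [IsManifold 𝓘(ℝ, ModelSpace d) ∞ M]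
  [RiemannianBundle (fun x : M => TangentSpace 𝓘(ℝ, ModelSpace d) x)]
  [IsContMDiffRiemannianBundle 𝓘(ℝ, ModelSpace d) ∞ (ModelSpace d)
      (fun x : M => TangentSpace 𝓘(ℝ, ModelSpace d) x)] in
theorem aemeasurable_chart_symm (c : M) : AEMeasurable (chartAt (ModelSpace d) c).symm
    ((volume : Measure (ModelSpace d)).restrict (chartAt (ModelSpace d) c).target) :=
  (chartAt (ModelSpace d) c).continuousOn_symm.aemeasurable
    (chartAt (ModelSpace d) c).open_target.measurableSet

omit [MeasurableSpace M] [BorelSpace M] in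
theorem aemeasurable_chartDensity (c : M) : AEMeasurable (chartDensity d M c)
    ((volume : Measure (ModelSpace d)).restrict (chartAt (ModelSpace d) c).target) :=
  ((continuousOn_sqrt_det c).aemeasurable
    (chartAt (ModelSpace d) c).open_target.measurableSet).ennreal_ofReal

theorem lintegral_chartVolume (c : M) {F : M → ℝ≥0∞} (hF : Measurable F) :
    ∫⁻ x, F x ∂(chartVolume d M c) = ∫⁻ y in (chartAt (ModelSpace d) c).target,
      chartDensity d M c y * F ((chartAt (ModelSpace d) c).symm y) := by
  have h1 := aemeasurable_chart_symm (d := d) c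
  unfold chartVolume
  rw [lintegral_map' hF.aemeasurable (h1.mono_ac (withDensity_absolutelyContinuous _ _))]
  exact lintegral_withDensity_eq_lintegral_mul₀ (aemeasurable_chartDensity c)
    (hF.comp_aemeasurable h1)

omit [IsManifold 𝓘(ℝ, ModelSpace d) ∞ M]
  [RiemannianBundle (fun x : M => TangentSpace 𝓘(ℝ, ModelSpace d) x)]
  [IsContMDiffRiemannianBundle 𝓘(ℝ, ModelSpace d) ∞ (ModelSpace d)
      (fun x : M => TangentSpace 𝓘(ℝ, ModelSpace d) x)] in
theorem measurableSet_target_inter_preimage (c : M) {S : Set M} (hS : MeasurableSet S) :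
    MeasurableSet ((chartAt (ModelSpace d) c).target ∩ (chartAt (ModelSpace d) c).symm ⁻¹' S) := by
  have h1 : Measurable (fun y : (chartAt (ModelSpace d) c).target =>
      (chartAt (ModelSpace d) c).symm y) :=
    (continuousOn_iff_continuous_domRestrict.mp
      (chartAt (ModelSpace d) c).continuousOn_symm).measurable
  have h2 := (chartAt (ModelSpace d) c).open_target.measurableSet.subtype_image (h1 hS)
  convert h2 using 1
  ext y
  simp [and_comm]

omit [IsManifold 𝓘(ℝ, ModelSpace d) ∞ M]
  [RiemannianBundle (fun x : M => TangentSpace 𝓘(ℝ, ModelSpace d) x)]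
  [IsContMDiffRiemannianBundle 𝓘(ℝ, ModelSpace d) ∞ (ModelSpace d)
      (fun x : M => TangentSpace 𝓘(ℝ, ModelSpace d) x)] in
theorem measurableSet_source_inter_preimage (c : M) {Q : Set (ModelSpace d)}
    (hQ : MeasurableSet Q) :
    MeasurableSet ((chartAt (ModelSpace d) c).source ∩ (chartAt (ModelSpace d) c) ⁻¹' Q) := by
  have h1 : Measurable (fun y : (chartAt (ModelSpace d) c).source =>
      (chartAt (ModelSpace d) c) y) :=
    (continuousOn_iff_continuous_domRestrict.mp
      (chartAt (ModelSpace d) c).continuousOn).measurable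
  have h2 := (chartAt (ModelSpace d) c).open_source.measurableSet.subtype_image (h1 hQ)
  convert h2 using 1
  ext y
  simp [and_comm]

theorem chartVolume_apply (c : M) {S : Set M} (hS : MeasurableSet S) :
    chartVolume d M c S = ∫⁻ y in (chartAt (ModelSpace d) c).target ∩
      (chartAt (ModelSpace d) c).symm ⁻¹' S, chartDensity d M c y := by
  have hT := measurableSet_target_inter_preimage (d := d) c hS
  rw [← lintegral_indicator_one hS, lintegral_chartVolume c (measurable_one.indicator hS),
    ← lintegral_indicator (chartAt (ModelSpace d) c).open_target.measurableSet,
    ← lintegral_indicator hT]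
  refine lintegral_congr fun y => ?_
  by_cases h1 : y ∈ (chartAt (ModelSpace d) c).target <;>
    by_cases h2 : (chartAt (ModelSpace d) c).symm y ∈ S <;> simp [h1, h2]

theorem chartVolume_compl_source (c : M) :
    chartVolume d M c (chartAt (ModelSpace d) c).sourceᶜ = 0 := by
  rw [chartVolume_apply c (chartAt (ModelSpace d) c).open_source.measurableSet.compl]
  have : (chartAt (ModelSpace d) c).target ∩
      (chartAt (ModelSpace d) c).symm ⁻¹' (chartAt (ModelSpace d) c).sourceᶜ = ∅ := by
    ext y
    simp only [Set.mem_inter_iff, Set.mem_preimage, Set.mem_compl_iff, Set.mem_empty_iff_false,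
      iff_false, not_and, not_not]
    exact fun hy => (chartAt (ModelSpace d) c).map_target hy
  rw [this]; simp

/-- Change of variables along the transition map `τ`: since `det g = (det Dτ) ^ 2 * det g'`, the
square root of the density absorbs the Jacobian `|det Dτ|`. -/
theorem chartVolume_eq_of_subset (c c' : M) {S : Set M} (hS : MeasurableSet S)
    (hc : S ⊆ (chartAt (ModelSpace d) c).source) (hc' : S ⊆ (chartAt (ModelSpace d) c').source) :
    chartVolume d M c S = chartVolume d M c' S := by
  set e := chartAt (ModelSpace d) c with he
  set e' := chartAt (ModelSpace d) c' with he'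
  have hT := measurableSet_target_inter_preimage (d := d) c hS
  rw [chartVolume_apply c hS, chartVolume_apply c' hS]
  set s := e.target ∩ e.symm ⁻¹' S with hs
  have himg : e'.target ∩ e'.symm ⁻¹' S = (e' ∘ e.symm) '' s := by
    ext z
    constructor
    · rintro ⟨hz, hzS⟩
      refine ⟨e (e'.symm z), ⟨e.map_source (hc hzS), ?_⟩, ?_⟩
      · rw [Set.mem_preimage, e.left_inv (hc hzS)]; exact hzS
      · rw [Function.comp_apply, e.left_inv (hc hzS), e'.right_inv hz]
    · rintro ⟨y, ⟨hy, hyS⟩, rfl⟩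
      refine ⟨e'.map_source (hc' hyS), ?_⟩
      rw [Set.mem_preimage, Function.comp_apply, e'.left_inv (hc' hyS)]; exact hyS
  have hinj : Set.InjOn (e' ∘ e.symm) s := by
    rintro y ⟨hy, hyS⟩ z ⟨hz, hzS⟩ h
    exact e.symm.injOn hy hz (e'.injOn (hc' hyS) (hc' hzS) h)
  rw [← he', himg, lintegral_image_eq_lintegral_abs_det_fderiv_mul volume hT
    (f' := fderiv ℝ (e' ∘ e.symm)) (fun y hy => (mfderiv_chart_symm_change c c' hy.1
      (hc' hy.2)).1.hasFDerivAt.hasFDerivWithinAt) hinj]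
  refine setLIntegral_congr_fun hT fun y hy => ?_
  simp only [chartDensity]
  rw [det_metricMatrix_change c c' hy.1 (hc' hy.2), Real.sqrt_mul (sq_nonneg _),
    Real.sqrt_sq_eq_abs, ENNReal.ofReal_mul (abs_nonneg _)]
  rfl

omit [IsManifold 𝓘(ℝ, ModelSpace d) ∞ M]
  [IsContMDiffRiemannianBundle 𝓘(ℝ, ModelSpace d) ∞ (ModelSpace d)
      (fun x : M => TangentSpace 𝓘(ℝ, ModelSpace d) x)] [BorelSpace M] in
theorem chartVolume_le_riemannianVolume (c : M) : chartVolume d M c ≤ riemannianVolume d M :=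
  le_iSup (chartVolume d M) c

theorem restrict_riemannianVolume (c : M) :
    (riemannianVolume d M).restrict (chartAt (ModelSpace d) c).source = chartVolume d M c := by
  set U := (chartAt (ModelSpace d) c).source with hU
  have hUm : MeasurableSet U := (chartAt (ModelSpace d) c).open_source.measurableSet
  apply le_antisymm
  -- The supremum of measures is hard to evaluate on a set, so a single measure is shown to dominate
  -- every `chartVolume d M c'`: inside `U` they agree with `chartVolume d M c` on overlaps, outside
  -- `U` the volume itself is a bound.
  · have hle : riemannianVolume d M ≤
        chartVolume d M c + (riemannianVolume d M).restrict Uᶜ := by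
      refine iSup_le fun c' => ?_
      have hU'm : MeasurableSet (chartAt (ModelSpace d) c').source :=
        (chartAt (ModelSpace d) c').open_source.measurableSet
      rw [← Measure.restrict_add_restrict_compl (μ := chartVolume d M c') hUm]
      refine add_le_add (Measure.le_iff.mpr fun S hS => ?_)
        (Measure.restrict_mono_measure (chartVolume_le_riemannianVolume c') _)
      rw [Measure.restrict_apply hS]
      calc chartVolume d M c' (S ∩ U)
          = chartVolume d M c' (S ∩ U ∩ (chartAt (ModelSpace d) c').source) := by
            rw [measure_inter_conull (chartVolume_compl_source c')]
        _ = chartVolume d M c (S ∩ U ∩ (chartAt (ModelSpace d) c').source) :=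
            chartVolume_eq_of_subset c' c ((hS.inter hUm).inter hU'm)
              Set.inter_subset_right (fun x hx => hx.1.2)
        _ ≤ chartVolume d M c S := measure_mono fun x hx => hx.1.1
    refine Measure.le_iff.mpr fun S hS => ?_
    rw [Measure.restrict_apply hS]
    refine (hle _).trans ?_
    rw [Measure.add_apply, Measure.restrict_apply (hS.inter hUm), Set.inter_assoc,
      Set.inter_compl_self, Set.inter_empty, measure_empty, add_zero]
    exact measure_mono Set.inter_subset_left
  · refine Measure.le_iff.mpr fun S hS => ?_
    rw [Measure.restrict_apply hS, ← measure_inter_conull (chartVolume_compl_source c)]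
    exact chartVolume_le_riemannianVolume c _

/-- The Riemannian volume in a chart. -/
theorem setLIntegral_riemannianVolume (c : M) {Q : Set (ModelSpace d)} (hQ : MeasurableSet Q)
    (hQt : Q ⊆ (chartAt (ModelSpace d) c).target) {F : M → ℝ≥0∞} (hF : Measurable F) :
    ∫⁻ x in (chartAt (ModelSpace d) c).source ∩ (chartAt (ModelSpace d) c) ⁻¹' Q, F x
        ∂(riemannianVolume d M) =
      ∫⁻ y in Q, chartDensity d M c y * F ((chartAt (ModelSpace d) c).symm y) := by
  have hA := measurableSet_source_inter_preimage (d := d) c hQ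
  rw [← Measure.restrict_restrict_of_subset (Set.inter_subset_left
      (s := (chartAt (ModelSpace d) c).source) (t := (chartAt (ModelSpace d) c) ⁻¹' Q)),
    restrict_riemannianVolume, ← lintegral_indicator hA,
    lintegral_chartVolume c (hF.indicator hA), ← lintegral_indicator hQ,
    ← lintegral_indicator (chartAt (ModelSpace d) c).open_target.measurableSet]
  refine lintegral_congr fun y => ?_
  by_cases h1 : y ∈ (chartAt (ModelSpace d) c).target
  · have h3 := (chartAt (ModelSpace d) c).map_target h1
    have h4 := (chartAt (ModelSpace d) c).right_inv h1
    by_cases h2 : y ∈ Q <;> simp [h1, h2, h3, h4]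
  · have h2 : y ∉ Q := fun h => h1 (hQt h)
    simp [h1, h2]

end Volume

/-! ### Pairings of covectors in frames that need not be orthonormal. -/

section LinearAlgebra

variable {T : Type*} [NormedAddCommGroup T] [InnerProductSpace ℝ T]

/-- The hypothesis says that `w` is a dual frame to `v`. The pairing is a contraction, so it may be
computed in any such pair; an orthonormal basis is dual to itself. -/
theorem sum_conj_mul_eq_of_dual {ι κ : Type*} [Fintype ι] [Fintype κ] (b : OrthonormalBasis ι ℝ T)
    {v w : κ → T} (hvw : ∀ x, ∑ i, inner ℝ (w i) x • v i = x) (α β : T →ₗ[ℝ] ℂ) :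
    ∑ i, (starRingEnd ℂ) (α (b i)) * β (b i) = ∑ i, (starRingEnd ℂ) (α (v i)) * β (w i) := by
  have h1 : ∀ i, (starRingEnd ℂ) (α (b i)) =
      ∑ j, (inner ℝ (w j) (b i) : ℂ) * (starRingEnd ℂ) (α (v j)) := by
    intro i
    conv_lhs => rw [← hvw (b i)]
    simp [map_sum, Complex.real_smul]
  have h2 : ∀ j, β (w j) = ∑ i, (inner ℝ (w j) (b i) : ℂ) * β (b i) := by
    intro j
    conv_lhs => rw [← b.sum_repr' (w j)]
    simp only [map_sum, map_smul, Complex.real_smul]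
    exact Finset.sum_congr rfl fun i _ => by rw [real_inner_comm]
  simp only [h1, h2, Finset.sum_mul, Finset.mul_sum]
  rw [Finset.sum_comm]
  refine Finset.sum_congr rfl fun j _ => Finset.sum_congr rfl fun i _ => ?_
  ring

/-- The dual frame of `A e_i` is obtained by applying the inverse Gram matrix. -/
theorem sum_conj_mul_eq_gram {d : ℕ} {ι : Type*} [Fintype ι] (b : OrthonormalBasis ι ℝ T)
    (A : ModelSpace d →ₗ[ℝ] T) (hA : Function.Bijective A) (α β : T →ₗ[ℝ] ℂ) :
    ∑ i, (starRingEnd ℂ) (α (b i)) * β (b i) =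
      ∑ i, ∑ j, ((Matrix.gram ℝ fun i => A (EuclideanSpace.single i 1))⁻¹ i j : ℂ) *
        ((starRingEnd ℂ) (α (A (EuclideanSpace.single i 1))) *
          β (A (EuclideanSpace.single j 1))) := by
  set v : Fin d → T := fun i => A (EuclideanSpace.single i 1) with hv
  set G := Matrix.gram ℝ v with hG
  have hdet : IsUnit G.det := (det_gram_pos A hA.injective).ne'.isUnit
  have hdual : ∀ i k, inner ℝ (∑ j, G⁻¹ i j • v j) (v k) = if i = k then 1 else 0 := by
    intro i k
    have := congrFun (congrFun (Matrix.nonsing_inv_mul G hdet) i) k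
    rw [Matrix.one_apply] at this
    rw [← this, Matrix.mul_apply, sum_inner]
    refine Finset.sum_congr rfl fun j _ => ?_
    rw [real_inner_smul_left, hG, Matrix.gram_apply]
  rw [sum_conj_mul_eq_of_dual b (v := v) (w := fun i => ∑ j, G⁻¹ i j • v j)]
  · refine Finset.sum_congr rfl fun i _ => ?_
    rw [map_sum, Finset.mul_sum]
    refine Finset.sum_congr rfl fun j _ => ?_
    rw [map_smul, Complex.real_smul]
    ring
  · intro x
    obtain ⟨u, rfl⟩ := hA.surjective x
    have hu : A u = ∑ k, u k • v k := by
      conv_lhs => rw [← (EuclideanSpace.basisFun (Fin d) ℝ).sum_repr u]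
      simp [hv]
    simp only [hu, inner_sum, real_inner_smul_right, hdual]
    simp

theorem norm_sq_le_sum_orthonormalBasis {ι : Type*} [Fintype ι] (b : OrthonormalBasis ι ℝ T)
    (α : T →ₗ[ℝ] ℂ) (v : T) : ‖α v‖ ^ 2 ≤ ‖v‖ ^ 2 * ∑ i, ‖α (b i)‖ ^ 2 := by
  have h1 : α v = ∑ i, (inner ℝ (b i) v : ℂ) * α (b i) := by
    conv_lhs => rw [← b.sum_repr' v]
    simp [map_sum, Complex.real_smul]
  have h2 : ‖α v‖ ≤ ∑ i, ‖inner ℝ (b i) v‖ * ‖α (b i)‖ := by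
    rw [h1]
    refine (norm_sum_le _ _).trans (le_of_eq ?_)
    simp
  calc ‖α v‖ ^ 2 ≤ (∑ i, ‖inner ℝ (b i) v‖ * ‖α (b i)‖) ^ 2 := by gcongr
    _ ≤ (∑ i, ‖inner ℝ (b i) v‖ ^ 2) * ∑ i, ‖α (b i)‖ ^ 2 :=
        Finset.sum_mul_sq_le_sq_mul_sq _ _ _
    _ = ‖v‖ ^ 2 * ∑ i, ‖α (b i)‖ ^ 2 := by rw [b.sum_sq_norm_inner_right]

theorem norm_apply_le_sum_sqrt_gram {d : ℕ} (A : ModelSpace d →ₗ[ℝ] T) (v : ModelSpace d) :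
    ‖A v‖ ≤ (∑ i, √(Matrix.gram ℝ (fun i => A (EuclideanSpace.single i 1)) i i)) * ‖v‖ := by
  have hu : A v = ∑ k, v k • A (EuclideanSpace.single k 1) := by
    conv_lhs => rw [← (EuclideanSpace.basisFun (Fin d) ℝ).sum_repr v]
    simp
  rw [hu, Finset.sum_mul]
  refine (norm_sum_le _ _).trans (Finset.sum_le_sum fun i _ => ?_)
  rw [norm_smul, Matrix.gram_apply, ← norm_eq_sqrt_real_inner, mul_comm]
  gcongr
  exact PiLp.norm_apply_le v i

end LinearAlgebra

/-! ### Continuity and local bounds for the gradient pairing. -/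

section Gradient

variable {d : ℕ} {M : Type*} [TopologicalSpace M] [ChartedSpace (ModelSpace d) M]
  [IsManifold 𝓘(ℝ, ModelSpace d) ∞ M]

omit [IsManifold 𝓘(ℝ, ModelSpace d) ∞ M] in
theorem IsSmooth.mdifferentiableAt {φ : M → ℂ} (hφ : IsSmooth d φ) (x : M) :
    MDifferentiableAt 𝓘(ℝ, ModelSpace d) 𝓘(ℝ, ℂ) φ x :=
  ContMDiffAt.mdifferentiableAt (hφ x) (by simp)

theorem IsSmooth.contDiffOn_comp_chart_symm {φ : M → ℂ} (hφ : IsSmooth d φ) (c : M) :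
    ContDiffOn ℝ 1 (φ ∘ (chartAt (ModelSpace d) c).symm) (chartAt (ModelSpace d) c).target := by
  have h := (ContMDiff.comp_contMDiffOn hφ (contMDiffOn_chart_symm (I := 𝓘(ℝ, ModelSpace d))
    (n := ∞) (x := c))).contDiffOn
  exact h.of_le (by simp)

theorem fderiv_comp_chart_symm {φ : M → ℂ} (hφ : IsSmooth d φ) (c : M) {y : ModelSpace d}
    (hy : y ∈ (chartAt (ModelSpace d) c).target) (v : ModelSpace d) :
    fderiv ℝ (φ ∘ (chartAt (ModelSpace d) c).symm) y v =
      dirDeriv d φ ((chartAt (ModelSpace d) c).symm y)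
        (mfderiv 𝓘(ℝ, ModelSpace d) 𝓘(ℝ, ModelSpace d) (chartAt (ModelSpace d) c).symm y v) := by
  have h := mfderiv_comp y (hφ.mdifferentiableAt ((chartAt (ModelSpace d) c).symm y))
    ((mdifferentiable_chart (I := 𝓘(ℝ, ModelSpace d)) c).mdifferentiableAt_symm hy)
  rw [mfderiv_eq_fderiv] at h
  exact congrArg (fun L : ModelSpace d →L[ℝ] ℂ => L v) h

variable [RiemannianBundle (fun x : M => TangentSpace 𝓘(ℝ, ModelSpace d) x)]

/-- The orthonormal bases in `gradInner` are chosen point by point, with no continuity. The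
coordinate formula removes that choice, and continuity of the pairing follows. -/
theorem gradInner_chart_symm {ψ φ : M → ℂ} (hψ : IsSmooth d ψ) (hφ : IsSmooth d φ) (c : M)
    {y : ModelSpace d} (hy : y ∈ (chartAt (ModelSpace d) c).target) :
    gradInner d ψ φ ((chartAt (ModelSpace d) c).symm y) =
      ∑ i, ∑ j, ((metricMatrix d M c y)⁻¹ i j : ℂ) *
        ((starRingEnd ℂ) (fderiv ℝ (ψ ∘ (chartAt (ModelSpace d) c).symm) y
          (EuclideanSpace.single i 1)) *
          fderiv ℝ (φ ∘ (chartAt (ModelSpace d) c).symm) y (EuclideanSpace.single j 1)) := by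
  have hbij : Function.Bijective (mfderiv 𝓘(ℝ, ModelSpace d) 𝓘(ℝ, ModelSpace d)
      (chartAt (ModelSpace d) c).symm y) :=
    (mdifferentiable_chart (I := 𝓘(ℝ, ModelSpace d)) c).symm.mfderiv_bijective hy
  simp only [fderiv_comp_chart_symm hψ c hy, fderiv_comp_chart_symm hφ c hy]
  exact sum_conj_mul_eq_gram
    (stdOrthonormalBasis ℝ (TangentSpace 𝓘(ℝ, ModelSpace d) ((chartAt (ModelSpace d) c).symm y)))
    (mfderiv 𝓘(ℝ, ModelSpace d) 𝓘(ℝ, ModelSpace d) (chartAt (ModelSpace d) c).symm y).toLinearMap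
    hbij (mfderiv 𝓘(ℝ, ModelSpace d) 𝓘(ℝ, ℂ) ψ ((chartAt (ModelSpace d) c).symm y)).toLinearMap
    (mfderiv 𝓘(ℝ, ModelSpace d) 𝓘(ℝ, ℂ) φ ((chartAt (ModelSpace d) c).symm y)).toLinearMap

omit [IsManifold 𝓘(ℝ, ModelSpace d) ∞ M] in
theorem gradInner_self (φ : M → ℂ) (x : M) :
    gradInner d φ φ x = ((∑ i, ‖dirDeriv d φ x
      (stdOrthonormalBasis ℝ (TangentSpace 𝓘(ℝ, ModelSpace d) x) i)‖ ^ 2 : ℝ) : ℂ) := by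
  simp only [gradInner, Complex.conj_mul', Complex.ofReal_sum, Complex.ofReal_pow]

omit [IsManifold 𝓘(ℝ, ModelSpace d) ∞ M] in
theorem norm_dirDeriv_sq_le (φ : M → ℂ) (x : M) (v : TangentSpace 𝓘(ℝ, ModelSpace d) x) :
    ‖dirDeriv d φ x v‖ ^ 2 ≤ ‖v‖ ^ 2 * ‖gradInner d φ φ x‖ := by
  have h := norm_sq_le_sum_orthonormalBasis
    (stdOrthonormalBasis ℝ (TangentSpace 𝓘(ℝ, ModelSpace d) x))
    (mfderiv 𝓘(ℝ, ModelSpace d) 𝓘(ℝ, ℂ) φ x).toLinearMap v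
  rw [gradInner_self, Complex.norm_real, Real.norm_of_nonneg (by positivity)]
  exact h

variable [IsContMDiffRiemannianBundle 𝓘(ℝ, ModelSpace d) ∞ (ModelSpace d)
      (fun x : M => TangentSpace 𝓘(ℝ, ModelSpace d) x)]

theorem continuousOn_inv_metricMatrix (c : M) :
    ContinuousOn (fun y => (metricMatrix d M c y)⁻¹) (chartAt (ModelSpace d) c).target := by
  have h := continuousOn_metricMatrix (d := d) c
  have hdet : ContinuousOn (fun y => (metricMatrix d M c y).det)
      (chartAt (ModelSpace d) c).target :=
    (Continuous.matrix_det continuous_id).comp_continuousOn h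
  have hadj : ContinuousOn (fun y => (metricMatrix d M c y).adjugate)
      (chartAt (ModelSpace d) c).target :=
    (Continuous.matrix_adjugate continuous_id).comp_continuousOn h
  simp only [Matrix.inv_def, Ring.inverse_eq_inv']
  exact (hdet.inv₀ fun y hy => (det_metricMatrix_pos c hy).ne').smul hadj

theorem continuous_gradInner {ψ φ : M → ℂ} (hψ : IsSmooth d ψ) (hφ : IsSmooth d φ) :
    Continuous (gradInner d ψ φ) := by
  rw [continuous_iff_continuousAt]
  intro x
  set e := chartAt (ModelSpace d) x with he
  have hd : ∀ {φ : M → ℂ}, IsSmooth d φ → ∀ i : Fin d, ContinuousOn (fun y =>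
      fderiv ℝ (φ ∘ e.symm) y (EuclideanSpace.single i 1)) e.target := fun hφ i =>
    ((hφ.contDiffOn_comp_chart_symm x).continuousOn_fderiv_of_isOpen e.open_target
      le_rfl).clm_apply continuousOn_const
  have hG := continuousOn_inv_metricMatrix (d := d) x
  have h1 : ContinuousOn (fun y => gradInner d ψ φ (e.symm y)) e.target := by
    refine ContinuousOn.congr ?_ fun y hy => gradInner_chart_symm hψ hφ x hy
    refine continuousOn_finsetSum _ fun i _ => continuousOn_finsetSum _ fun j _ => ?_
    refine ContinuousOn.mul ?_ ((Complex.continuous_conj.comp_continuousOn (hd hψ i)).mul (hd hφ j))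
    exact Complex.continuous_ofReal.comp_continuousOn
      (continuousOn_pi.mp (continuousOn_pi.mp hG i) j)
  have h2 : ContinuousOn (fun z => gradInner d ψ φ (e.symm (e z))) e.source :=
    h1.comp e.continuousOn e.mapsTo
  have h3 : ContinuousOn (gradInner d ψ φ) e.source :=
    h2.congr fun z hz => by simp only [e.left_inv hz]
  exact h3.continuousAt (e.open_source.mem_nhds (mem_chart_source _ x))

open scoped NNReal ENNReal

/-- Uniform comparison of the metric with the Euclidean metric in a coordinate ball. -/
theorem exists_chart_ball (c : M) : ∃ r : ℝ, 0 < r ∧ ∃ C : ℝ≥0,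
    Metric.closedBall (chartAt (ModelSpace d) c c) r ⊆ (chartAt (ModelSpace d) c).target ∧
    ∀ y ∈ Metric.closedBall (chartAt (ModelSpace d) c c) r,
      chartDensity d M c y ≤ C ∧ 1 ≤ C * chartDensity d M c y ∧
      ∀ {φ : M → ℂ}, IsSmooth d φ → ‖fderiv ℝ (φ ∘ (chartAt (ModelSpace d) c).symm) y‖ₑ ^ 2 ≤
        C * ‖gradInner d φ φ ((chartAt (ModelSpace d) c).symm y)‖ₑ := by
  set e := chartAt (ModelSpace d) c with he
  set y₀ := e c with hy₀
  have hy₀t : y₀ ∈ e.target := e.map_source (mem_chart_source _ c)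
  have hnhds := e.open_target.mem_nhds hy₀t
  set w : ModelSpace d → ℝ := fun y => √(metricMatrix d M c y).det with hw
  have hwc : ContinuousAt w y₀ := (continuousOn_sqrt_det c).continuousAt hnhds
  have hwpos : ∀ y ∈ e.target, 0 < w y := fun y hy =>
    Real.sqrt_pos.mpr (det_metricMatrix_pos c hy)
  have hwi : ContinuousAt (fun y => (w y)⁻¹) y₀ := hwc.inv₀ (hwpos _ hy₀t).ne'
  set s : ModelSpace d → ℝ := fun y => (∑ i, √(metricMatrix d M c y i i)) ^ 2 with hs
  have hsc : ContinuousAt s y₀ := by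
    refine ContinuousOn.continuousAt ?_ hnhds
    refine (continuousOn_finsetSum _ fun i _ => ?_).pow 2
    exact Real.continuous_sqrt.comp_continuousOn
      (continuousOn_pi.mp (continuousOn_pi.mp (continuousOn_metricMatrix c) i) i)
  -- The density, its inverse and the bound `s` for the squared norm of the inverse chart's
  -- derivative are continuous at `y₀`, so each stays below its value there plus one. The maximum of
  -- these three bounds serves as `C`, for all `φ` at once.
  have hev : ∀ᶠ y in 𝓝 y₀, y ∈ e.target ∧ w y < w y₀ + 1 ∧ (w y)⁻¹ < (w y₀)⁻¹ + 1 ∧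
      s y < s y₀ + 1 :=
    (eventually_mem_set.mpr hnhds).and ((hwc.eventually_lt_const (lt_add_one _)).and
      ((hwi.eventually_lt_const (lt_add_one _)).and (hsc.eventually_lt_const (lt_add_one _))))
  obtain ⟨r, hr, hball⟩ := Metric.nhds_basis_closedBall.eventually_iff.mp hev
  set C : ℝ := max (w y₀ + 1) (max ((w y₀)⁻¹ + 1) (s y₀ + 1)) with hC
  refine ⟨r, hr, C.toNNReal, fun y hy => (hball hy).1, fun y hy => ?_⟩
  obtain ⟨hyt, h1, h2, h3⟩ := hball hy
  have hwy := hwpos y hyt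
  have hC0 : 0 ≤ C := le_max_of_le_left (by positivity)
  have hCe : ((C.toNNReal : ℝ≥0) : ℝ≥0∞) = ENNReal.ofReal C := rfl
  rw [hCe]
  refine ⟨ENNReal.ofReal_le_ofReal (h1.le.trans (le_max_left _ _)), ?_, fun {φ} hφ => ?_⟩
  · rw [chartDensity, ← ENNReal.ofReal_mul hC0, ← ENNReal.ofReal_one]
    refine ENNReal.ofReal_le_ofReal ?_
    have : (w y)⁻¹ ≤ C := h2.le.trans ((le_max_left _ _).trans (le_max_right _ _))
    calc (1 : ℝ) = (w y)⁻¹ * w y := (inv_mul_cancel₀ hwy.ne').symm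
      _ ≤ C * w y := by gcongr
  · set g := ‖gradInner d φ φ (e.symm y)‖ with hg
    have hsC : s y ≤ C := h3.le.trans ((le_max_right _ _).trans (le_max_right _ _))
    have hop : ‖fderiv ℝ (φ ∘ e.symm) y‖ ≤ √(s y * g) := by
      refine ContinuousLinearMap.opNorm_le_bound _ (Real.sqrt_nonneg _) fun v => ?_
      rw [fderiv_comp_chart_symm hφ c hyt v]
      have h5 := norm_dirDeriv_sq_le φ (e.symm y)
        (mfderiv 𝓘(ℝ, ModelSpace d) 𝓘(ℝ, ModelSpace d) e.symm y v)
      have h6 := norm_apply_le_sum_sqrt_gram (T := TangentSpace 𝓘(ℝ, ModelSpace d) (e.symm y))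
        (mfderiv 𝓘(ℝ, ModelSpace d) 𝓘(ℝ, ModelSpace d) e.symm y).toLinearMap v
      refine le_of_sq_le_sq ?_ (by positivity)
      rw [mul_pow, Real.sq_sqrt (by positivity)]
      refine h5.trans ?_
      calc _ ≤ ((∑ i, √(metricMatrix d M c y i i)) * ‖v‖) ^ 2 * g := by
            gcongr
            exact h6
        _ = _ := by rw [mul_pow, hs]; ring
    have h7 : ‖fderiv ℝ (φ ∘ e.symm) y‖ ^ 2 ≤ C * g := by
      calc _ ≤ √(s y * g) ^ 2 := by gcongr
        _ = s y * g := Real.sq_sqrt (by positivity)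
        _ ≤ C * g := by gcongr
    rw [← ofReal_norm, ← ofReal_norm, ← ENNReal.ofReal_pow (norm_nonneg _),
      ← ENNReal.ofReal_mul hC0]
    exact ENNReal.ofReal_le_ofReal h7

end Gradient

/-! ### Rellich's theorem in quantitative form. -/

section Rellich

open scoped ENNReal NNReal

theorem IsSmooth.exists_norm_le {d : ℕ} {M : Type*} [TopologicalSpace M]
    [ChartedSpace (ModelSpace d) M] [CompactSpace M] {φ : M → ℂ} (hφ : IsSmooth d φ) :
    ∃ B, ∀ x, ‖φ x‖ ≤ B := by
  obtain ⟨B, hB⟩ := isCompact_univ.exists_bound_of_continuousOn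
    (ContMDiff.continuous hφ).continuousOn
  exact ⟨B, fun x => hB x (Set.mem_univ x)⟩

variable {d : ℕ} {M : Type*} [TopologicalSpace M] [ChartedSpace (ModelSpace d) M]
  [IsManifold 𝓘(ℝ, ModelSpace d) ∞ M]
  [RiemannianBundle (fun x : M => TangentSpace 𝓘(ℝ, ModelSpace d) x)]
  [IsContMDiffRiemannianBundle 𝓘(ℝ, ModelSpace d) ∞ (ModelSpace d)
      (fun x : M => TangentSpace 𝓘(ℝ, ModelSpace d) x)]
  [MeasurableSpace M] [BorelSpace M]

variable (d) in
/-- The part of the manifold whose coordinates in the chart at `c` lie in `Q`. -/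
def chartPiece (c : M) (Q : Set (ModelSpace d)) : Set M :=
  (chartAt (ModelSpace d) c).source ∩ (chartAt (ModelSpace d) c) ⁻¹' Q

theorem riemannianVolume_chartPiece_le (c : M) {Q : Set (ModelSpace d)} (hQ : MeasurableSet Q)
    (hQt : Q ⊆ (chartAt (ModelSpace d) c).target) {C : ℝ≥0}
    (hC : ∀ y ∈ Q, chartDensity d M c y ≤ C) :
    riemannianVolume d M (chartPiece d c Q) ≤ C * volume Q := by
  have h := setLIntegral_riemannianVolume c hQ hQt (measurable_one (α := ℝ≥0∞) (β := M))
  simp only [Pi.one_apply, lintegral_one, Measure.restrict_apply, MeasurableSet.univ,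
    Set.univ_inter, mul_one] at h
  calc riemannianVolume d M (chartPiece d c Q) = ∫⁻ y in Q, chartDensity d M c y := h
    _ ≤ ∫⁻ _ in Q, C := setLIntegral_mono' hQ hC
    _ = C * volume Q := setLIntegral_const _ _

theorem isFiniteMeasure_riemannianVolume [CompactSpace M] :
    IsFiniteMeasure (riemannianVolume d M) := by
  refine ⟨?_⟩
  refine isCompact_univ.measure_lt_top_of_nhdsWithin fun c _ => ?_
  obtain ⟨r, hr, C, hball, hC⟩ := exists_chart_ball (d := d) c
  refine ⟨chartPiece d c (Metric.closedBall (chartAt (ModelSpace d) c c) r), ?_, ?_⟩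
  · refine mem_nhdsWithin_of_mem_nhds (inter_mem ?_ ?_)
    · exact (chartAt (ModelSpace d) c).open_source.mem_nhds (mem_chart_source _ c)
    · exact ((chartAt (ModelSpace d) c).continuousAt (mem_chart_source _ c)).preimage_mem_nhds
        (Metric.closedBall_mem_nhds _ hr)
  · refine (riemannianVolume_chartPiece_le c Metric.isClosed_closedBall.measurableSet hball
      fun y hy => (hC y hy).1).trans_lt ?_
    exact ENNReal.mul_lt_top ENNReal.coe_lt_top (isCompact_closedBall _ _).measure_lt_top

/-- The oscillation of a smooth function on a small convex piece of a chart. -/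
theorem lintegral_chartPiece_oscillation_le [SFinite (riemannianVolume d M)]
    (c : M) {Q : Set (ModelSpace d)} (hQ : MeasurableSet Q)
    (hQc : Convex ℝ Q) (hQt : Q ⊆ (chartAt (ModelSpace d) c).target) {C : ℝ≥0}
    (hC : ∀ y ∈ Q, chartDensity d M c y ≤ C ∧ 1 ≤ C * chartDensity d M c y ∧
      ∀ {φ : M → ℂ}, IsSmooth d φ → ‖fderiv ℝ (φ ∘ (chartAt (ModelSpace d) c).symm) y‖ₑ ^ 2 ≤
        C * ‖gradInner d φ φ ((chartAt (ModelSpace d) c).symm y)‖ₑ)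
    {δ : ℝ≥0∞} (hδ : ∀ x ∈ Q, ∀ y ∈ Q, ‖x - y‖ₑ ≤ δ) {φ : M → ℂ} (hφ : IsSmooth d φ) :
    ∫⁻ x in chartPiece d c Q, ∫⁻ y in chartPiece d c Q, ‖φ y - φ x‖ₑ ^ 2
        ∂(riemannianVolume d M) ∂(riemannianVolume d M) ≤
      riemannianVolume d M (chartPiece d c Q) * (C ^ 5 * 2 ^ d * δ ^ 2 *
        ∫⁻ x in chartPiece d c Q, ‖gradInner d φ φ x‖ₑ ∂(riemannianVolume d M)) := by
  set V := riemannianVolume d M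
  set e := chartAt (ModelSpace d) c
  set A := chartPiece d c Q with hA
  have hφm : Measurable φ := (ContMDiff.continuous hφ).measurable
  have hfor : ∀ {F : M → ℝ≥0∞}, Measurable F →
      ∫⁻ x in A, F x ∂V = ∫⁻ y in Q, chartDensity d M c y * F (e.symm y) := fun hF =>
    setLIntegral_riemannianVolume c hQ hQt hF
  have hup : ∀ {F : M → ℝ≥0∞}, Measurable F →
      ∫⁻ x in A, F x ∂V ≤ C * ∫⁻ y in Q, F (e.symm y) := fun {F} hF => by
    rw [hfor hF, ← lintegral_const_mul' _ _ ENNReal.coe_ne_top]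
    exact setLIntegral_mono' hQ fun y hy => mul_le_mul' (hC y hy).1 le_rfl
  have hlow : ∀ {F : M → ℝ≥0∞}, Measurable F →
      ∫⁻ y in Q, F (e.symm y) ≤ C * ∫⁻ x in A, F x ∂V := fun {F} hF => by
    rw [hfor hF, ← lintegral_const_mul' _ _ ENNReal.coe_ne_top]
    refine setLIntegral_mono' hQ fun y hy => ?_
    calc F (e.symm y) = 1 * F (e.symm y) := (one_mul _).symm
      _ ≤ C * chartDensity d M c y * F (e.symm y) := mul_le_mul' (hC y hy).2.1 le_rfl
      _ = _ := mul_assoc _ _ _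
  have hvol : volume Q ≤ C * V A := by
    have := hlow (measurable_one (α := ℝ≥0∞) (β := M))
    simpa using this
  have hm2 : Measurable fun p : M × M => ‖φ p.2 - φ p.1‖ₑ ^ 2 :=
    ((hφm.comp measurable_snd).sub (hφm.comp measurable_fst)).enorm.pow_const 2
  have hm1 : Measurable fun x => ∫⁻ y in A, ‖φ y - φ x‖ₑ ^ 2 ∂V := hm2.lintegral_prod_right'
  have hmg : Measurable fun x => ‖gradInner d φ φ x‖ₑ :=
    (continuous_gradInner hφ hφ).measurable.enorm
  -- The power `C ^ 5` collects two passages from Riemannian to Lebesgue integrals, the bound of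
  -- `volume Q` by `V A`, the comparison of the derivative with the gradient, and the passage back
  -- to the Riemannian integral.
  calc ∫⁻ x in A, ∫⁻ y in A, ‖φ y - φ x‖ₑ ^ 2 ∂V ∂V
      ≤ C * ∫⁻ x in Q, ∫⁻ y in A, ‖φ y - φ (e.symm x)‖ₑ ^ 2 ∂V := hup hm1
    _ ≤ C * ∫⁻ x in Q, C * ∫⁻ y in Q, ‖φ (e.symm y) - φ (e.symm x)‖ₑ ^ 2 := by
        refine mul_le_mul' le_rfl (lintegral_mono fun x => ?_)
        exact hup ((hφm.sub_const _).enorm.pow_const 2)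
    _ = C * (C * ∫⁻ x in Q, ∫⁻ y in Q, ‖(φ ∘ e.symm) y - (φ ∘ e.symm) x‖ₑ ^ 2) := by
        rw [lintegral_const_mul' _ _ ENNReal.coe_ne_top]; rfl
    _ ≤ C * (C * (δ ^ 2 * (2 ^ d * volume Q * ∫⁻ y in Q, ‖fderiv ℝ (φ ∘ e.symm) y‖ₑ ^ 2))) := by
        refine mul_le_mul' le_rfl (mul_le_mul' le_rfl ?_)
        have := lintegral_lintegral_enorm_sub_sq_le (μ := volume) hQc hQ e.open_target hQt
          (hφ.contDiffOn_comp_chart_symm c) hδ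
        rwa [finrank_euclideanSpace_fin] at this
    _ ≤ C * (C * (δ ^ 2 * (2 ^ d * (C * V A) *
          (C * (C * ∫⁻ x in A, ‖gradInner d φ φ x‖ₑ ∂V))))) := by
        gcongr
        refine le_trans ?_ (mul_le_mul' le_rfl (hlow hmg))
        rw [← lintegral_const_mul' _ _ ENNReal.coe_ne_top]
        exact setLIntegral_mono' hQ fun y hy => (hC y hy).2.2 hφ
    _ = _ := by ring

/-- The mean square inequality with the oscillation bound inserted, divided by the volume of the
piece. This gives `a = 2 / V A`; a null piece is treated apart. -/
theorem exists_lintegral_chartPiece_le [CompactSpace M]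
    (c : M) {Q : Set (ModelSpace d)} (hQ : MeasurableSet Q)
    (hQc : Convex ℝ Q) (hQt : Q ⊆ (chartAt (ModelSpace d) c).target) {C : ℝ≥0}
    (hC : ∀ y ∈ Q, chartDensity d M c y ≤ C ∧ 1 ≤ C * chartDensity d M c y ∧
      ∀ {φ : M → ℂ}, IsSmooth d φ → ‖fderiv ℝ (φ ∘ (chartAt (ModelSpace d) c).symm) y‖ₑ ^ 2 ≤
        C * ‖gradInner d φ φ ((chartAt (ModelSpace d) c).symm y)‖ₑ)
    {δ : ℝ≥0∞} (hδ : ∀ x ∈ Q, ∀ y ∈ Q, ‖x - y‖ₑ ≤ δ) :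
    ∃ a : ℝ≥0, ∀ {φ : M → ℂ}, IsSmooth d φ →
      ∫⁻ x in chartPiece d c Q, ‖φ x‖ₑ ^ 2 ∂(riemannianVolume d M) ≤
        a * ‖∫ x in chartPiece d c Q, φ x ∂(riemannianVolume d M)‖ₑ ^ 2 +
        2 * (C ^ 5 * 2 ^ d * δ ^ 2) *
          ∫⁻ x in chartPiece d c Q, ‖gradInner d φ φ x‖ₑ ∂(riemannianVolume d M) := by
  have hfin : IsFiniteMeasure (riemannianVolume d M) := isFiniteMeasure_riemannianVolume
  set V := riemannianVolume d M
  set A := chartPiece d c Q with hA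
  by_cases h0 : V A = 0
  · refine ⟨0, fun {φ} hφ => ?_⟩
    rw [Measure.restrict_eq_zero.mpr h0]
    simp
  have htop : V A ≠ ⊤ := measure_ne_top _ _
  refine ⟨(2 * (V A)⁻¹).toNNReal, fun {φ} hφ => ?_⟩
  rw [ENNReal.coe_toNNReal (ENNReal.mul_ne_top (by simp) (ENNReal.inv_ne_top.mpr h0))]
  have hφm : Measurable φ := (ContMDiff.continuous hφ).measurable
  obtain ⟨B, hB⟩ := hφ.exists_norm_le
  have hi : Integrable φ (V.restrict A) :=
    Integrable.of_bound hφm.aestronglyMeasurable B (ae_of_all _ hB)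
  have h1 := lintegral_enorm_sq_le_average (ν := V.restrict A) hφm hi
  have h2 := lintegral_chartPiece_oscillation_le c hQ hQc hQt hC hδ hφ
  rw [Measure.restrict_apply_univ] at h1
  rw [← ENNReal.mul_le_mul_iff_right h0 htop]
  refine h1.trans ((add_le_add le_rfl (mul_le_mul' le_rfl h2)).trans (le_of_eq ?_))
  have h3 : V A * (2 * (V A)⁻¹) = 2 := by
    rw [mul_left_comm, ENNReal.mul_inv_cancel h0 htop, mul_one]
  rw [mul_add, ← mul_assoc (V A) (2 * (V A)⁻¹), h3]
  congr 1
  simp only [V, A]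
  ring

variable (d) in
/-- On `B`, the `L²` norm of smooth functions is controlled by finitely many integrals, up to a
small multiple of the Dirichlet energy. -/
def HasFiniteRankControl (B : Set M) : Prop :=
  ∀ ε : ℝ≥0, 0 < ε → ∃ (n : ℕ) (A : Fin n → Set M) (a : ℝ≥0), (∀ i, MeasurableSet (A i)) ∧
    ∀ {φ : M → ℂ}, IsSmooth d φ → ∫⁻ x in B, ‖φ x‖ₑ ^ 2 ∂(riemannianVolume d M) ≤
      a * ∑ i, ‖∫ x in A i, φ x ∂(riemannianVolume d M)‖ₑ ^ 2 +
      ε * ∫⁻ x, ‖gradInner d φ φ x‖ₑ ∂(riemannianVolume d M)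

/-- The energy coefficient on each piece depends on its diameter and not on the number of pieces.
The pieces being disjoint, their energies add up to at most the total; only `a` grows with the
partition. -/
theorem hasFiniteRankControl_chart_ball [CompactSpace M] (c : M) :
    ∃ B ∈ 𝓝 c, HasFiniteRankControl d B := by
  obtain ⟨r, hr, C, hball, hC⟩ := exists_chart_ball (d := d) c
  set K := Metric.closedBall (chartAt (ModelSpace d) c c) r with hK
  have hKm : MeasurableSet K := Metric.isClosed_closedBall.measurableSet
  refine ⟨chartPiece d c K, ?_, fun ε hε => ?_⟩
  · refine inter_mem ?_ ?_
    · exact (chartAt (ModelSpace d) c).open_source.mem_nhds (mem_chart_source _ c)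
    · exact ((chartAt (ModelSpace d) c).continuousAt (mem_chart_source _ c)).preimage_mem_nhds
        (Metric.closedBall_mem_nhds _ hr)
  obtain ⟨δ, hδ, hδε⟩ : ∃ δ : ℝ≥0, 0 < δ ∧ 2 * (C ^ 5 * 2 ^ d * δ ^ 2) ≤ ε := by
    set D := 2 * (C ^ 5 * 2 ^ d) with hD
    -- As `δ ≤ 1`, `D * δ ^ 2 ≤ D * δ`, and this is at most `ε`.
    refine ⟨min 1 (ε / (D + 1)), lt_min one_pos (by positivity), ?_⟩
    set δ := min 1 (ε / (D + 1)) with hδ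
    calc 2 * (C ^ 5 * 2 ^ d * δ ^ 2) = D * δ * δ := by rw [hD]; ring
      _ ≤ (D + 1) * (ε / (D + 1)) * 1 := by
          gcongr
          · exact le_self_add
          · exact min_le_right _ _
          · exact min_le_left _ _
      _ = ε := by rw [mul_one, mul_div_cancel₀ _ (by positivity)]
  obtain ⟨n, Q, hQc, hQm, hQK, hQd, hKQ, hQδ⟩ := exists_convex_partition
    (convex_closedBall _ _) hKm Metric.isBounded_closedBall (NNReal.coe_pos.mpr hδ)
  have hpiece : ∀ i, ∃ a : ℝ≥0, ∀ {φ : M → ℂ}, IsSmooth d φ →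
      ∫⁻ x in chartPiece d c (Q i), ‖φ x‖ₑ ^ 2 ∂(riemannianVolume d M) ≤
        a * ‖∫ x in chartPiece d c (Q i), φ x ∂(riemannianVolume d M)‖ₑ ^ 2 +
        2 * (C ^ 5 * 2 ^ d * (δ : ℝ≥0∞) ^ 2) *
          ∫⁻ x in chartPiece d c (Q i), ‖gradInner d φ φ x‖ₑ ∂(riemannianVolume d M) := fun i =>
    exists_lintegral_chartPiece_le c (hQm i) (hQc i) ((hQK i).trans hball)
      (fun y hy => hC y (hQK i hy)) (fun x hx y hy => by
        rw [← ofReal_norm, ← ENNReal.ofReal_coe_nnreal]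
        exact ENNReal.ofReal_le_ofReal (hQδ i x hx y hy))
  choose a ha using hpiece
  have hAm : ∀ i, MeasurableSet (chartPiece d c (Q i)) := fun i =>
    measurableSet_source_inter_preimage c (hQm i)
  refine ⟨n, fun i => chartPiece d c (Q i), ∑ i, a i, hAm, fun {φ} hφ => ?_⟩
  have hAd : Pairwise (Function.onFun Disjoint fun i => chartPiece d c (Q i)) := fun i j hij =>
    Disjoint.mono Set.inter_subset_right Set.inter_subset_right ((hQd hij).preimage _)
  have hsub : chartPiece d c K ⊆ ⋃ i, chartPiece d c (Q i) := by
    rintro x ⟨hx, hxK⟩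
    obtain ⟨i, hi⟩ := Set.mem_iUnion.mp (hKQ hxK)
    exact Set.mem_iUnion.mpr ⟨i, hx, hi⟩
  set V := riemannianVolume d M
  calc ∫⁻ x in chartPiece d c K, ‖φ x‖ₑ ^ 2 ∂V
      ≤ ∑ i, ∫⁻ x in chartPiece d c (Q i), ‖φ x‖ₑ ^ 2 ∂V := by
        refine (lintegral_mono_set hsub).trans (le_of_eq ?_)
        rw [lintegral_iUnion hAm hAd, tsum_fintype]
    _ ≤ ∑ i, (a i * ‖∫ x in chartPiece d c (Q i), φ x ∂V‖ₑ ^ 2 + ε *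
          ∫⁻ x in chartPiece d c (Q i), ‖gradInner d φ φ x‖ₑ ∂V) := by
        refine Finset.sum_le_sum fun i _ => (ha i hφ).trans ?_
        gcongr
        exact_mod_cast hδε
    _ ≤ _ := by
        rw [Finset.sum_add_distrib, ← Finset.mul_sum]
        refine add_le_add ?_ (mul_le_mul' le_rfl ?_)
        · rw [Finset.mul_sum]
          refine Finset.sum_le_sum fun i hi => mul_le_mul' ?_ le_rfl
          exact_mod_cast Finset.single_le_sum (f := a) (fun _ _ => zero_le) hi
        · rw [← tsum_fintype (L := .unconditional _), ← lintegral_iUnion hAm hAd]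
          exact setLIntegral_le_lintegral _ _

/-- The quantitative form of Rellich's theorem. -/
theorem hasFiniteRankControl_univ [CompactSpace M] :
    HasFiniteRankControl d (Set.univ : Set M) := by
  -- The property passes to subsets and, with `ε` halved, to unions of two sets. By compactness it
  -- is enough to have it near each point.
  refine isCompact_univ.induction_on (p := HasFiniteRankControl d) ?_ ?_ ?_ ?_
  · exact fun ε hε => ⟨0, Fin.elim0, 0, fun i => i.elim0, fun {φ} hφ => by simp⟩
  · intro s t hst ht ε hε
    obtain ⟨n, A, a, hA, h⟩ := ht ε hε
    exact ⟨n, A, a, hA, fun {φ} hφ => (lintegral_mono_set hst).trans (h hφ)⟩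
  · intro s t hs ht ε hε
    obtain ⟨n, A, a, hA, h⟩ := hs (ε / 2) (half_pos hε)
    obtain ⟨n', A', a', hA', h'⟩ := ht (ε / 2) (half_pos hε)
    refine ⟨n + n', Fin.append A A', a + a', ?_, fun {φ} hφ => ?_⟩
    · intro i
      induction i using Fin.addCases with
      | left i => simpa using hA i
      | right i => simpa using hA' i
    · refine (lintegral_union_le _ s t).trans ((add_le_add (h hφ) (h' hφ)).trans ?_)
      rw [Fin.sum_univ_add]
      simp only [Fin.append_left, Fin.append_right]
      set E := ∫⁻ x, ‖gradInner d φ φ x‖ₑ ∂(riemannianVolume d M)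
      set S := ∑ i, ‖∫ x in A i, φ x ∂(riemannianVolume d M)‖ₑ ^ 2
      set S' := ∑ i, ‖∫ x in A' i, φ x ∂(riemannianVolume d M)‖ₑ ^ 2
      have hε2 : (ε : ℝ≥0∞) = ((ε / 2 : ℝ≥0) : ℝ≥0∞) + ((ε / 2 : ℝ≥0) : ℝ≥0∞) := by
        rw [← ENNReal.coe_add, add_halves]
      rw [hε2, ENNReal.coe_add]
      calc _ = a * S + a' * S' + (((ε / 2 : ℝ≥0) : ℝ≥0∞) + ((ε / 2 : ℝ≥0) : ℝ≥0∞)) * E := by ring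
        _ ≤ (a + a') * S + (a + a') * S' +
            (((ε / 2 : ℝ≥0) : ℝ≥0∞) + ((ε / 2 : ℝ≥0) : ℝ≥0∞)) * E := by
          gcongr
          · exact le_self_add
          · exact le_add_self
        _ = _ := by ring
  · intro c _
    obtain ⟨B, hB, h⟩ := hasFiniteRankControl_chart_ball (d := d) c
    exact ⟨B, mem_nhdsWithin_of_mem_nhds hB, h⟩

end Rellich

/-! ### The `H¹` space of smooth functions and the resolvent of the Laplacian. -/

section SmoothFunctions

variable {d : ℕ} {M : Type*} [TopologicalSpace M] [ChartedSpace (ModelSpace d) M]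

theorem IsSmooth.add {φ ψ : M → ℂ} (hφ : IsSmooth d φ) (hψ : IsSmooth d ψ) :
    IsSmooth d (φ + ψ) :=
  ContMDiff.add hφ hψ

theorem IsSmooth.const_smul {φ : M → ℂ} (hφ : IsSmooth d φ) (a : ℂ) : IsSmooth d (a • φ) :=
  (ContinuousLinearMap.contMDiff (a • ContinuousLinearMap.id ℝ ℂ)).comp hφ

theorem dirDeriv_add {φ ψ : M → ℂ} (hφ : IsSmooth d φ) (hψ : IsSmooth d ψ) (x : M)
    (v : TangentSpace 𝓘(ℝ, ModelSpace d) x) :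
    dirDeriv d (φ + ψ) x v = dirDeriv d φ x v + dirDeriv d ψ x v :=
  congrArg (fun L : ModelSpace d →L[ℝ] ℂ => L v)
    (mfderiv_add (hφ.mdifferentiableAt x) (hψ.mdifferentiableAt x))

theorem dirDeriv_const_smul {φ : M → ℂ} (hφ : IsSmooth d φ) (a : ℂ) (x : M)
    (v : TangentSpace 𝓘(ℝ, ModelSpace d) x) :
    dirDeriv d (a • φ) x v = a * dirDeriv d φ x v := by
  have h := ((a • ContinuousLinearMap.id ℝ ℂ).hasMFDerivAt (x := φ x)).comp x
    (hφ.mdifferentiableAt x).hasMFDerivAt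
  exact congrArg (fun L : ModelSpace d →L[ℝ] ℂ => L v) h.mfderiv

variable (d M) in
/-- The smooth functions, as a subspace of all functions. -/
def smoothSubmodule : Submodule ℂ (M → ℂ) where
  carrier := {φ | IsSmooth d φ}
  add_mem' hφ hψ := hφ.add hψ
  zero_mem' := contMDiff_const
  smul_mem' a _ hφ := hφ.const_smul a

variable (d M) in
/-- The space of smooth functions, to be normed by the `H¹` norm. -/
def SmoothSpace : Type _ := smoothSubmodule d M

instance : AddCommGroup (SmoothSpace d M) := inferInstanceAs (AddCommGroup (smoothSubmodule d M))

instance : Module ℂ (SmoothSpace d M) := inferInstanceAs (Module ℂ (smoothSubmodule d M))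

/-- The function underlying an element of `SmoothSpace`. -/
def SmoothSpace.toFun (φ : SmoothSpace d M) : M → ℂ := φ.1

theorem SmoothSpace.isSmooth (φ : SmoothSpace d M) : IsSmooth d φ.toFun := φ.2

theorem SmoothSpace.toFun_add (φ ψ : SmoothSpace d M) : (φ + ψ).toFun = φ.toFun + ψ.toFun := rfl

theorem SmoothSpace.toFun_smul (a : ℂ) (φ : SmoothSpace d M) : (a • φ).toFun = a • φ.toFun := rfl

variable [RiemannianBundle (fun x : M => TangentSpace 𝓘(ℝ, ModelSpace d) x)]

theorem gradInner_conj (ψ φ : M → ℂ) (x : M) :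
    (starRingEnd ℂ) (gradInner d φ ψ x) = gradInner d ψ φ x := by
  simp only [gradInner, map_sum, map_mul, Complex.conj_conj]
  exact Finset.sum_congr rfl fun i _ => mul_comm _ _

theorem gradInner_add_left {ψ ψ' : M → ℂ} (hψ : IsSmooth d ψ) (hψ' : IsSmooth d ψ') (φ : M → ℂ)
    (x : M) : gradInner d (ψ + ψ') φ x = gradInner d ψ φ x + gradInner d ψ' φ x := by
  simp only [gradInner, dirDeriv_add hψ hψ', map_add, add_mul, Finset.sum_add_distrib]

theorem gradInner_smul_left {ψ : M → ℂ} (hψ : IsSmooth d ψ) (a : ℂ) (φ : M → ℂ) (x : M) :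
    gradInner d (a • ψ) φ x = (starRingEnd ℂ) a * gradInner d ψ φ x := by
  simp only [gradInner, dirDeriv_const_smul hψ, map_mul, mul_assoc, Finset.mul_sum]

theorem gradInner_self_eq_norm (φ : M → ℂ) (x : M) :
    gradInner d φ φ x = (‖gradInner d φ φ x‖ : ℂ) := by
  rw [gradInner_self, Complex.norm_real, Real.norm_of_nonneg (by positivity)]

variable [MeasurableSpace M]

theorem dirichletForm_self (φ : M → ℂ) :
    dirichletForm d φ φ = ((∫ x, ‖gradInner d φ φ x‖ ∂(riemannianVolume d M) : ℝ) : ℂ) := by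
  rw [← integral_complex_ofReal]
  exact integral_congr_ae (ae_of_all _ (gradInner_self_eq_norm φ))

variable [IsManifold 𝓘(ℝ, ModelSpace d) ∞ M]
  [IsContMDiffRiemannianBundle 𝓘(ℝ, ModelSpace d) ∞ (ModelSpace d)
      (fun x : M => TangentSpace 𝓘(ℝ, ModelSpace d) x)]
  [BorelSpace M] [CompactSpace M]

instance : IsFiniteMeasure (riemannianVolume d M) := isFiniteMeasure_riemannianVolume

theorem integrable_gradInner {ψ φ : M → ℂ} (hψ : IsSmooth d ψ) (hφ : IsSmooth d φ) :
    Integrable (gradInner d ψ φ) (riemannianVolume d M) := by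
  have hc := continuous_gradInner hψ hφ
  obtain ⟨B, hB⟩ := isCompact_univ.exists_bound_of_continuousOn hc.continuousOn
  exact Integrable.of_bound hc.measurable.aestronglyMeasurable B
    (ae_of_all _ fun x => hB x (Set.mem_univ x))

theorem IsSmooth.memLp {φ : M → ℂ} (hφ : IsSmooth d φ) : MemLp φ 2 (riemannianVolume d M) := by
  obtain ⟨B, hB⟩ := hφ.exists_norm_le
  exact MemLp.of_bound (ContMDiff.continuous hφ).measurable.aestronglyMeasurable B
    (ae_of_all _ hB)

variable (d M) in
/-- The inclusion of the smooth functions into `L²`. -/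
def smoothToL2 : SmoothSpace d M →ₗ[ℂ] L2 d M where
  toFun φ := φ.isSmooth.memLp.toLp φ.toFun
  map_add' _ _ := rfl
  map_smul' _ _ := rfl

theorem coeFn_smoothToL2 (φ : SmoothSpace d M) :
    smoothToL2 d M φ =ᵐ[riemannianVolume d M] φ.toFun :=
  φ.isSmooth.memLp.coeFn_toLp

/-- The `H¹` inner product. -/
@[reducible] def h1Core : PreInnerProductSpace.Core ℂ (SmoothSpace d M) where
  inner ψ φ := inner ℂ (smoothToL2 d M ψ) (smoothToL2 d M φ) + dirichletForm d ψ.toFun φ.toFun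
  conj_inner_symm ψ φ := by
    rw [map_add, inner_conj_symm]
    congr 1
    rw [dirichletForm, ← integral_conj]
    exact integral_congr_ae (ae_of_all _ fun x => gradInner_conj _ _ x)
  re_inner_nonneg φ := by
    rw [map_add, dirichletForm_self]
    refine add_nonneg inner_self_nonneg ?_
    exact integral_nonneg fun x => norm_nonneg _
  add_left ψ ψ' φ := by
    have : dirichletForm d (ψ + ψ').toFun φ.toFun =
        dirichletForm d ψ.toFun φ.toFun + dirichletForm d ψ'.toFun φ.toFun := by
      rw [dirichletForm, SmoothSpace.toFun_add]
      simp only [gradInner_add_left ψ.isSmooth ψ'.isSmooth]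
      exact integral_add (integrable_gradInner ψ.isSmooth φ.isSmooth)
        (integrable_gradInner ψ'.isSmooth φ.isSmooth)
    rw [map_add, inner_add_left, this]
    ring
  smul_left ψ φ a := by
    have : dirichletForm d (a • ψ).toFun φ.toFun =
        (starRingEnd ℂ) a * dirichletForm d ψ.toFun φ.toFun := by
      rw [dirichletForm, SmoothSpace.toFun_smul]
      simp only [gradInner_smul_left ψ.isSmooth]
      exact integral_const_mul _ _
    rw [map_smul, inner_smul_left, this]
    ring

/-- Definiteness need not be checked, because the completion is separated in any case. -/
instance : SeminormedAddCommGroup (SmoothSpace d M) :=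
  InnerProductSpace.Core.toSeminormedAddCommGroup (𝕜 := ℂ) (c := h1Core)

instance : InnerProductSpace ℂ (SmoothSpace d M) := InnerProductSpace.ofCore h1Core

theorem SmoothSpace.inner_eq (ψ φ : SmoothSpace d M) : inner ℂ ψ φ =
    inner ℂ (smoothToL2 d M ψ) (smoothToL2 d M φ) + dirichletForm d ψ.toFun φ.toFun := rfl

theorem SmoothSpace.norm_sq_eq (φ : SmoothSpace d M) :
    ‖φ‖ ^ 2 = ‖smoothToL2 d M φ‖ ^ 2 + ‖dirichletForm d φ.toFun φ.toFun‖ := by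
  rw [← inner_self_eq_norm_sq (𝕜 := ℂ), SmoothSpace.inner_eq, map_add, inner_self_eq_norm_sq,
    dirichletForm_self, Complex.norm_real,
    Real.norm_of_nonneg (integral_nonneg fun x => norm_nonneg _)]
  rfl

theorem norm_smoothToL2_le (φ : SmoothSpace d M) : ‖smoothToL2 d M φ‖ ≤ ‖φ‖ := by
  refine le_of_sq_le_sq ?_ (norm_nonneg _)
  rw [SmoothSpace.norm_sq_eq]
  exact le_add_of_nonneg_right (norm_nonneg _)

variable (d M) in
/-- The inclusion of the smooth functions into `L²`, as a bounded operator for the `H¹` norm. -/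
def smoothInclusion : SmoothSpace d M →L[ℂ] L2 d M :=
  (smoothToL2 d M).mkContinuous 1 fun φ => by rw [one_mul]; exact norm_smoothToL2_le φ

theorem smoothInclusion_apply (φ : SmoothSpace d M) :
    smoothInclusion d M φ = smoothToL2 d M φ := rfl

open scoped ENNReal NNReal

theorem smoothInclusion_norm_sq_le (ε : ℝ) (hε : 0 < ε) :
    ∃ (n : ℕ) (e : Fin n → L2 d M) (C : ℝ), ∀ φ : SmoothSpace d M,
      ‖smoothInclusion d M φ‖ ^ 2 ≤
        C * ∑ i, ‖inner ℂ (e i) (smoothInclusion d M φ)‖ ^ 2 + ε ^ 2 * ‖φ‖ ^ 2 := by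
  obtain ⟨n, A, a, hA, h⟩ := hasFiniteRankControl_univ (d := d) (M := M) (Real.toNNReal (ε ^ 2))
    (Real.toNNReal_pos.mpr (by positivity))
  -- The integral over `A i` is the inner product with the indicator of `A i`, and the Dirichlet
  -- energy is part of the squared `H¹` norm.
  refine ⟨n, fun i => indicatorConstLp 2 (hA i) (measure_ne_top _ _) 1, a, fun φ => ?_⟩
  rw [smoothInclusion_apply]
  have hae := coeFn_smoothToL2 φ
  have h1 : ENNReal.ofReal (‖smoothToL2 d M φ‖ ^ 2) =
      ∫⁻ x in Set.univ, ‖φ.toFun x‖ₑ ^ 2 ∂(riemannianVolume d M) := by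
    rw [Measure.restrict_univ, ENNReal.ofReal_pow (norm_nonneg _), ofReal_norm, Lp.enorm_def,
      eLpNorm_congr_ae hae]
    have := eLpNorm_nnreal_pow_eq_lintegral (f := φ.toFun) (μ := riemannianVolume d M)
      (p := (2 : ℝ≥0)) two_ne_zero
    simpa using this
  have h2 : ∀ i, inner ℂ (indicatorConstLp 2 (hA i) (measure_ne_top _ _) (1 : ℂ))
      (smoothToL2 d M φ) = ∫ x in A i, φ.toFun x ∂(riemannianVolume d M) := fun i => by
    rw [L2.inner_indicatorConstLp_one]
    exact integral_congr_ae (ae_restrict_of_ae hae)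
  have h3 : ∫⁻ x, ‖gradInner d φ.toFun φ.toFun x‖ₑ ∂(riemannianVolume d M) =
      ENNReal.ofReal ‖dirichletForm d φ.toFun φ.toFun‖ := by
    rw [dirichletForm_self, Complex.norm_real,
      Real.norm_of_nonneg (integral_nonneg fun x => norm_nonneg _),
      ofReal_integral_norm_eq_lintegral_enorm (integrable_gradInner φ.isSmooth φ.isSmooth)]
  have h4 := h φ.isSmooth
  rw [← h1, h3] at h4
  simp only [h2]
  set S := ∑ i, ‖∫ x in A i, φ.toFun x ∂(riemannianVolume d M)‖ ^ 2 with hS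
  set D := ‖dirichletForm d φ.toFun φ.toFun‖ with hD
  have hS0 : 0 ≤ S := Finset.sum_nonneg fun i _ => by positivity
  have hSe : ∑ i, ‖∫ x in A i, φ.toFun x ∂(riemannianVolume d M)‖ₑ ^ 2 = ENNReal.ofReal S := by
    rw [hS, ENNReal.ofReal_sum_of_nonneg fun i _ => by positivity]
    exact Finset.sum_congr rfl fun i _ => by
      rw [ENNReal.ofReal_pow (norm_nonneg _), ofReal_norm]
  have hε2 : ((Real.toNNReal (ε ^ 2) : ℝ≥0) : ℝ≥0∞) = ENNReal.ofReal (ε ^ 2) := rfl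
  rw [hSe, hε2, ← ENNReal.ofReal_coe_nnreal, ← ENNReal.ofReal_mul (NNReal.coe_nonneg _),
    ← ENNReal.ofReal_mul (by positivity), ← ENNReal.ofReal_add (by positivity) (by positivity),
    ENNReal.ofReal_le_ofReal_iff (by positivity)] at h4
  refine h4.trans ?_
  gcongr
  rw [SmoothSpace.norm_sq_eq]
  exact le_add_of_nonneg_left (by positivity)

/-- Continuous functions are dense in `L²`, and smooth ones are uniformly dense among them: local
constants near the values of `g` are glued into a smooth function, balls being convex. -/
theorem denseRange_smoothInclusion [T2Space M] : DenseRange (smoothInclusion d M) := by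
  have : SecondCountableTopology M :=
    ChartedSpace.secondCountable_of_sigmaCompact (ModelSpace d) M
  have : TopologicalSpace.MetrizableSpace M :=
    TopologicalSpace.metrizableSpace_of_t3_secondCountable M
  have hL : DenseRange (ContinuousMap.toLp 2 (riemannianVolume d M) ℂ :
      C(M, ℂ) →L[ℂ] L2 d M) := ContinuousMap.toLp_denseRange ℂ _ ℂ (by simp)
  have hS : DenseRange fun φ : SmoothSpace d M =>
      (⟨φ.toFun, ContMDiff.continuous φ.isSmooth⟩ : C(M, ℂ)) := by
    rw [Metric.denseRange_iff]
    intro g ε hε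
    obtain ⟨φ, hφ⟩ := exists_contMDiffMap_forall_mem_convex_of_local_const (n := ⊤)
      𝓘(ℝ, ModelSpace d) (t := fun x => Metric.ball (g x) (ε / 2))
      (fun x => convex_ball _ _) (fun x => ⟨g x, by
        filter_upwards [g.continuous.continuousAt.eventually
          (Metric.ball_mem_nhds (g x) (half_pos hε))] with y hy
        rw [Metric.mem_ball, dist_comm]
        exact hy⟩)
    refine ⟨⟨φ, φ.contMDiff⟩, ?_⟩
    refine lt_of_le_of_lt ((ContinuousMap.dist_le (half_pos hε).le).mpr fun x => ?_)
      (half_lt_self hε)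
    rw [dist_comm]
    exact (Metric.mem_ball.mp (hφ x)).le
  exact hL.comp hS (ContinuousLinearMap.continuous _)

variable (d M) in
/-- The operator `(1 - Δ)⁻¹`. -/
def resolvent : L2 d M →L[ℂ] L2 d M := solutionOperator (smoothInclusion d M)

theorem inner_smoothToL2 (ψ : SmoothSpace d M) (w : L2 d M) :
    inner ℂ (smoothToL2 d M ψ) w =
      ∫ x, (starRingEnd ℂ) (ψ.toFun x) * w x ∂(riemannianVolume d M) := by
  rw [L2.inner_def]
  refine integral_congr_ae ?_
  filter_upwards [coeFn_smoothToL2 ψ] with x hx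
  rw [hx, RCLike.inner_apply, mul_comm]

theorem tendsto_smoothToL2_iff (Φ : ℕ → SmoothSpace d M) (u : L2 d M) :
    Tendsto (fun n => smoothToL2 d M (Φ n)) atTop (𝓝 u) ↔
      Tendsto (fun n => eLpNorm (fun x => u x - (Φ n).toFun x) 2 (riemannianVolume d M))
        atTop (𝓝 0) := by
  rw [tendsto_iff_edist_tendsto_0]
  refine tendsto_congr fun n => ?_
  rw [edist_comm, Lp.edist_def]
  refine eLpNorm_congr_ae ?_
  filter_upwards [coeFn_smoothToL2 (Φ n)] with x hx
  rw [Pi.sub_apply, hx]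

/-- The squared `H¹` distance is the squared `L²` distance plus the energy of the difference, and
the first summand already tends to zero. -/
theorem cauchySeq_iff_of_tendsto (Φ : ℕ → SmoothSpace d M) {u : L2 d M}
    (hu : Tendsto (fun n => smoothToL2 d M (Φ n)) atTop (𝓝 u)) :
    CauchySeq Φ ↔ Tendsto (fun p : ℕ × ℕ => ‖dirichletForm d ((Φ p.1).toFun - (Φ p.2).toFun)
      ((Φ p.1).toFun - (Φ p.2).toFun)‖) atTop (𝓝 0) := by
  have hd : ∀ p : ℕ × ℕ, dist (Φ p.1) (Φ p.2) ^ 2 =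
      dist (smoothToL2 d M (Φ p.1)) (smoothToL2 d M (Φ p.2)) ^ 2 +
        ‖dirichletForm d ((Φ p.1).toFun - (Φ p.2).toFun) ((Φ p.1).toFun - (Φ p.2).toFun)‖ := by
    intro p
    rw [dist_eq_norm, SmoothSpace.norm_sq_eq, map_sub, dist_eq_norm]
    rfl
  have hJ : Tendsto (fun p : ℕ × ℕ => dist (smoothToL2 d M (Φ p.1)) (smoothToL2 d M (Φ p.2)) ^ 2)
      atTop (𝓝 0) := by
    simpa using (cauchySeq_iff_tendsto_dist_atTop_0.mp hu.cauchySeq).pow 2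
  rw [cauchySeq_iff_tendsto_dist_atTop_0]
  constructor
  · intro h
    have h2 := (h.pow 2).sub hJ
    simp only [hd] at h2
    simpa using h2
  · intro h
    have h2 := (hJ.add h)
    simp only [← hd] at h2
    have h3 := (Real.continuous_sqrt.tendsto _).comp h2
    simpa [Function.comp_def, Real.sqrt_sq dist_nonneg] using h3

/-- `Δ u = w` if and only if `(1 - Δ)⁻¹ (u - w) = u`. -/
theorem hasLaplacian_iff (u w : L2 d M) : HasLaplacian u w ↔ resolvent d M (u - w) = u := by
  rw [resolvent, solutionOperator_eq_iff]
  -- The `H¹` pairing is the `L²` pairing plus the Dirichlet form. The `L²` part tends to `⟪ψ, u⟫`,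
  -- so subtracting it turns the limit `⟪ψ, u - w⟫` into `-⟪ψ, w⟫`.
  have key : ∀ (Φ : ℕ → SmoothSpace d M),
      Tendsto (fun n => smoothToL2 d M (Φ n)) atTop (𝓝 u) → ∀ ψ : SmoothSpace d M,
      (Tendsto (fun n => inner ℂ ψ (Φ n)) atTop (𝓝 (inner ℂ (smoothToL2 d M ψ) (u - w))) ↔
      Tendsto (fun n => dirichletForm d ψ.toFun (Φ n).toFun) atTop
        (𝓝 (-∫ x, (starRingEnd ℂ) (ψ.toFun x) * w x ∂(riemannianVolume d M)))) := by
    intro Φ hu ψ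
    have h1 : Tendsto (fun n => inner ℂ (smoothToL2 d M ψ) (smoothToL2 d M (Φ n))) atTop
        (𝓝 (inner ℂ (smoothToL2 d M ψ) u)) := tendsto_const_nhds.inner hu
    rw [← inner_smoothToL2, inner_sub_right]
    constructor
    · intro h
      have h2 := h.sub h1
      simpa only [SmoothSpace.inner_eq, add_sub_cancel_left, sub_sub_cancel_left] using h2
    · intro h
      have h2 := h1.add h
      simpa only [SmoothSpace.inner_eq, ← sub_eq_add_neg] using h2
  constructor
  · rintro ⟨φ, hφ, h⟩
    let Φ : ℕ → SmoothSpace d M := fun n => ⟨φ n, hφ.smooth n⟩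
    have hu : Tendsto (fun n => smoothToL2 d M (Φ n)) atTop (𝓝 u) :=
      (tendsto_smoothToL2_iff Φ u).mpr hφ.tendsto
    exact ⟨Φ, (cauchySeq_iff_of_tendsto Φ hu).mpr hφ.cauchy, hu,
      fun ψ => (key Φ hu ψ).mpr (h ψ.toFun ψ.isSmooth)⟩
  · rintro ⟨Φ, hc, hu, h⟩
    refine ⟨fun n => (Φ n).toFun, ⟨fun n => (Φ n).isSmooth, (tendsto_smoothToL2_iff Φ u).mp hu,
      (cauchySeq_iff_of_tendsto Φ hu).mp hc⟩, fun ψ hψ => ?_⟩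
    exact (key Φ hu ⟨ψ, hψ⟩).mp (h ⟨ψ, hψ⟩)

end SmoothFunctions

/-! ### The eigenfunction expansion. -/

section Spectral

variable {d : ℕ} {M : Type*} [TopologicalSpace M] [CompactSpace M] [T2Space M]
  [ChartedSpace (ModelSpace d) M] [IsManifold 𝓘(ℝ, ModelSpace d) ∞ M]
  [RiemannianBundle (fun x : M => TangentSpace 𝓘(ℝ, ModelSpace d) x)]
  [IsContMDiffRiemannianBundle 𝓘(ℝ, ModelSpace d) ∞ (ModelSpace d)
      (fun x : M => TangentSpace 𝓘(ℝ, ModelSpace d) x)]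
  [MeasurableSpace M] [BorelSpace M]

omit [T2Space M] in
theorem isEigenfunction_iff (l : ℝ) (u : L2 d M) :
    IsEigenfunction l u ↔ u ≠ 0 ∧ (1 + (l : ℂ) ^ 2) • resolvent d M u = u := by
  rw [IsEigenfunction, hasLaplacian_iff]
  have : u - (-(l : ℂ) ^ 2) • u = (1 + (l : ℂ) ^ 2) • u := by module
  rw [this, map_smul]

-- The eigenfunctions for `l`, together with zero, are the kernel of a bounded operator. It is
-- already a closed subspace, so taking the span and its closure adds nothing.
omit [T2Space M] in
theorem mem_eigenspace_iff (l : ℝ) (u : L2 d M) :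
    u ∈ eigenspace d M l ↔ (1 + (l : ℂ) ^ 2) • resolvent d M u = u := by
  constructor
  · intro hu
    let K : Submodule ℂ (L2 d M) :=
      ((1 + (l : ℂ) ^ 2) • resolvent d M - ContinuousLinearMap.id ℂ (L2 d M)).ker
    have hK : IsClosed (K : Set (L2 d M)) := ContinuousLinearMap.isClosed_ker _
    have hle : eigenspace d M l ≤ K := by
      refine Submodule.topologicalClosure_minimal _ (Submodule.span_le.mpr fun v hv => ?_) hK
      exact sub_eq_zero.mpr ((isEigenfunction_iff l v).mp hv).2
    exact sub_eq_zero.mp (hle hu)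
  · intro hu
    by_cases h0 : u = 0
    · rw [h0]; exact zero_mem _
    · exact Submodule.le_topologicalClosure _
        (Submodule.subset_span ((isEigenfunction_iff l u).mpr ⟨h0, hu⟩))

instance (l : ℝ) : CompleteSpace (eigenspace d M l) := by
  unfold eigenspace
  infer_instance

omit [CompactSpace M] [T2Space M] [IsManifold 𝓘(ℝ, ModelSpace d) ∞ M]
  [IsContMDiffRiemannianBundle 𝓘(ℝ, ModelSpace d) ∞ (ModelSpace d)
      (fun x : M => TangentSpace 𝓘(ℝ, ModelSpace d) x)] [BorelSpace M] in
theorem spectralProjection_mem (l : ℝ) (f : L2 d M) :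
    spectralProjection d M l f ∈ eigenspace d M l := by
  unfold spectralProjection
  exact Submodule.starProjection_apply_mem _ _

omit [CompactSpace M] [T2Space M] [IsManifold 𝓘(ℝ, ModelSpace d) ∞ M]
  [IsContMDiffRiemannianBundle 𝓘(ℝ, ModelSpace d) ∞ (ModelSpace d)
      (fun x : M => TangentSpace 𝓘(ℝ, ModelSpace d) x)] [BorelSpace M] in
theorem inner_spectralProjection (l : ℝ) {g : L2 d M} (hg : g ∈ eigenspace d M l) (f : L2 d M) :
    inner ℂ g (spectralProjection d M l f) = inner ℂ g f := by
  unfold spectralProjection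
  rw [← Submodule.inner_starProjection_left_eq_right, Submodule.starProjection_eq_self_iff.mpr hg]

-- Eigenvectors of the symmetric resolvent for different eigenvalues are orthogonal. Nonnegativity
-- of `l` and `l'` makes `l ^ 2` determine `l`.
omit [T2Space M] in
theorem inner_eigenspace_eq_zero {l l' : ℝ} (hl : 0 ≤ l) (hl' : 0 ≤ l') (hne : l ≠ l')
    {g h : L2 d M} (hg : g ∈ eigenspace d M l) (hh : h ∈ eigenspace d M l') :
    inner ℂ g h = 0 := by
  rw [mem_eigenspace_iff] at hg hh
  have hsymm : inner ℂ (resolvent d M g) h = inner ℂ g (resolvent d M h) :=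
    isSymmetric_solutionOperator (smoothInclusion d M) g h
  have h1 : (1 + (l' : ℂ) ^ 2) * inner ℂ g h = (1 + (l : ℂ) ^ 2) * inner ℂ g h := by
    calc (1 + (l' : ℂ) ^ 2) * inner ℂ g h
        = (1 + (l' : ℂ) ^ 2) * inner ℂ ((1 + (l : ℂ) ^ 2) • resolvent d M g) h := by rw [hg]
      _ = (1 + (l : ℂ) ^ 2) * ((1 + (l' : ℂ) ^ 2) * inner ℂ g (resolvent d M h)) := by
          rw [inner_smul_left, hsymm]
          simp only [map_add, map_one, map_pow, Complex.conj_ofReal]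
          ring
      _ = (1 + (l : ℂ) ^ 2) * inner ℂ g h := by
          rw [← inner_smul_right, hh]
  by_contra h0
  have h2 := mul_right_cancel₀ h0 h1
  have h3 : l' ^ 2 = l ^ 2 := by exact_mod_cast add_left_cancel h2
  exact hne ((pow_left_inj₀ hl' hl two_ne_zero).mp h3).symm

/-- The eigenfunctions of the Laplace--Beltrami operator are complete. -/
theorem eq_zero_of_inner_eigenspace_eq_zero {f : L2 d M}
    (hf : ∀ l ∈ spectralParameters d M, ∀ g ∈ eigenspace d M l, inner ℂ g f = 0) : f = 0 := by
  have hcomp : IsCompactOperator (resolvent d M) :=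
    isCompactOperator_solutionOperator _ smoothInclusion_norm_sq_le
  have hbot := ContinuousLinearMap.orthogonalComplement_iSup_eigenspaces_eq_bot hcomp
    (isSymmetric_solutionOperator (smoothInclusion d M))
  suffices f ∈ (⨆ μ, Module.End.eigenspace (resolvent d M : Module.End ℂ (L2 d M)) μ)ᗮ by
    rw [hbot] at this
    exact (Submodule.mem_bot ℂ).mp this
  rw [Submodule.mem_orthogonal]
  intro g hg
  induction hg using Submodule.iSup_induction' with
  | mem μ g hg =>
    by_cases hg0 : g = 0
    · rw [hg0, inner_zero_left]
    have hT : resolvent d M g = μ • g := Module.End.mem_eigenspace_iff.mp hg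
    -- Every eigenvector of the resolvent is an eigenfunction of the Laplacian. The eigenvalue `0`
    -- is excluded by injectivity, and the others have the form `1 / (1 + l ^ 2)`.
    obtain ⟨l, hl, hlμ⟩ := exists_eq_of_solutionOperator_eq_smul (smoothInclusion d M)
      norm_smoothToL2_le denseRange_smoothInclusion hg0 hT
    have hgl : (1 + (l : ℂ) ^ 2) • resolvent d M g = g := by
      rw [hT, smul_smul, hlμ, one_smul]
    exact hf l ⟨hl, g, (isEigenfunction_iff l g).mpr ⟨hg0, hgl⟩⟩ g
      ((mem_eigenspace_iff l g).mpr hgl)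
  | zero => exact inner_zero_left _
  | add g h _ _ hg hh => rw [inner_add_left, hg, hh, add_zero]

omit [CompactSpace M] [T2Space M] [IsManifold 𝓘(ℝ, ModelSpace d) ∞ M]
  [IsContMDiffRiemannianBundle 𝓘(ℝ, ModelSpace d) ∞ (ModelSpace d)
      (fun x : M => TangentSpace 𝓘(ℝ, ModelSpace d) x)] [BorelSpace M] in
theorem summable_norm_spectralProjection {f : L2 d M} (hf : hatL1Norm f < ⊤) :
    Summable fun l : spectralParameters d M => ‖spectralProjection d M l f‖ := by
  have := ENNReal.summable_toReal hf.ne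
  simpa only [toReal_enorm] using this

/-- Absolute convergence gives a sum `S`. Paired with an eigenvector, the series keeps a single
term, equal to the pairing with `f`; so `f - S` is orthogonal to every eigenspace and vanishes by
completeness. -/
theorem hasSum_spectralProjection {f : L2 d M} (hf : hatL1Norm f < ⊤) :
    HasSum (fun l : spectralParameters d M => spectralProjection d M l f) f := by
  have hs := (summable_norm_spectralProjection hf).of_norm.hasSum
  set S := ∑' l : spectralParameters d M, spectralProjection d M l f
  suffices f - S = 0 by rwa [← sub_eq_zero.mp this] at hs
  refine eq_zero_of_inner_eigenspace_eq_zero fun l hl g hg => ?_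
  have h1 : HasSum (fun l' : spectralParameters d M => inner ℂ g (spectralProjection d M l' f))
      (inner ℂ g S) := (innerSL ℂ g).hasSum hs
  have h2 := hasSum_single (f := fun l' : spectralParameters d M =>
    inner ℂ g (spectralProjection d M l' f)) ⟨l, hl⟩ fun l' hl' =>
      inner_eigenspace_eq_zero hl.1 l'.2.1 (fun h => hl' (Subtype.ext h.symm)) hg
        (spectralProjection_mem _ f)
  rw [inner_sub_right, h1.unique h2, inner_spectralProjection l hg, sub_self]

end Spectral

end RiemannianSpectral

end

/-! ### Sampling from the eigenfunction expansion. -/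

theorem mainTheorem4 (d : ℕ) (M : Type*) [TopologicalSpace M] [CompactSpace M] [T2Space M]
    [ChartedSpace (ModelSpace d) M] [IsManifold 𝓘(ℝ, ModelSpace d) ∞ M]
    [RiemannianBundle (fun x : M => TangentSpace 𝓘(ℝ, ModelSpace d) x)]
    [IsContMDiffRiemannianBundle 𝓘(ℝ, ModelSpace d) ∞ (ModelSpace d)
      (fun x : M => TangentSpace 𝓘(ℝ, ModelSpace d) x)]
    [MeasurableSpace M] [BorelSpace M]
    (f : RiemannianSpectral.L2 d M) (hf : f ≠ 0)
    (hf1 : RiemannianSpectral.hatL1Norm f < ⊤)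
    (η : ℝ) (hη : 0 < η) (k : ℕ)
    (hk : (RiemannianSpectral.fourierRatio f ^ 2 - 1) / η ^ 2 < (k : ℝ)) :
    ∃ (l : Fin k → ℝ) (c : Fin k → ℂ),
      (∀ i, l i ∈ RiemannianSpectral.spectralParameters d M ∧
        RiemannianSpectral.IsEigenfunction (l i)
          (RiemannianSpectral.spectralProjection d M (l i) f)) ∧
      ‖(∑ i, c i • RiemannianSpectral.spectralProjection d M (l i) f) - f‖ < η * ‖f‖ := by
  have hfr : RiemannianSpectral.fourierRatio f =
      (∑' l : RiemannianSpectral.spectralParameters d M,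
        ‖RiemannianSpectral.spectralProjection d M l f‖) / ‖f‖ := by
    rw [RiemannianSpectral.fourierRatio, RiemannianSpectral.hatL1Norm,
      ENNReal.tsum_toReal_eq fun _ => enorm_ne_top]
    simp only [toReal_enorm]
  rw [hfr] at hk
  obtain ⟨j, c, hj, hjc⟩ := RiemannianSpectral.exists_sparse_approximation hf
    (RiemannianSpectral.hasSum_spectralProjection hf1)
    (RiemannianSpectral.summable_norm_spectralProjection hf1) hη hk
  exact ⟨fun i => j i, c, fun i => ⟨(j i).2, (RiemannianSpectral.isEigenfunction_iff _ _).mpr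
    ⟨hj i, (RiemannianSpectral.mem_eigenspace_iff _ _).mp
      (RiemannianSpectral.spectralProjection_mem _ f)⟩⟩, hjc⟩
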